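/- For real $x$ let $\|x\|=\min_{n\in\mathbb Z}|x-n|$. The type of an irrational number $\gamma$ is $$\tau=\sup\Bigl\{\varrho\in\mathbb R:\ \liminf_{n\to\infty,\ n\in\mathbb N} n^{\varrho}\,\|\gamma n\|=0\Bigr\},$$ and $\gamma$ is of finite type if $\tau<\infty$. Let $\Lambda$ be the von Mangoldt function, with $\Lambda(k)=0$ for integers $k\le 0$. **Theorem.** Let $\alpha>0$ be an irrational real number of finite type. Then there is a constant $\kappa>0$, depending only on $\alpha$, such that for every real number $\beta$ there is a constant $C$, depending only on $\alpha$ and $\beta$, with the following property: for all integers $N\ge 1$ and all integers $a,q$ with $0\le a<q\le N^{\kappa}$ and $\gcd(a,q)=1$, $$\left|\ \sum_{1\le n\le N}\Lambda\bigl(q\lfloor\alpha n+\beta\rfloor+a\bigr)-\alpha^{-1}\sum_{1\le m\le\lfloor\alpha N+\beta\rfloor}\Lambda(qm+a)\ \right|\le C\,N^{1-\kappa}.$$ (An empty sum is $0$.) -/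

import Mathlib

/-- `‖x‖`, the distance from the real number `x` to the nearest integer. -/
noncomputable def distNearestInt (x : ℝ) : ℝ := |x - round x|

/-- `distNearestInt x` is the minimum of `|x - n|` over the integers `n`. -/
theorem isLeast_distNearestInt (x : ℝ) :
    IsLeast (Set.range fun n : ℤ => |x - n|) (distNearestInt x) :=
  ⟨⟨round x, rfl⟩, by rintro _ ⟨n, rfl⟩; exact round_le x n⟩

/-- The type of `γ`: the supremum of all real `ϱ` with `liminf_{n → ∞} n ^ ϱ * ‖γ * n‖ = 0`.
Both the lower limit and the supremum are taken in the extended reals, so that `∞` is a genuine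
value of either. -/
noncomputable def diophantineType (γ : ℝ) : EReal :=
  sSup ((fun ϱ : ℝ => (ϱ : EReal)) ''
    {ϱ : ℝ | Filter.liminf
      (fun n : ℕ => (((n : ℝ) ^ ϱ * distNearestInt (γ * n) : ℝ) : EReal)) Filter.atTop = 0})

/-- `γ` is of finite type if its type is not `∞`. -/
def IsOfFiniteType (γ : ℝ) : Prop := diophantineType γ < ⊤

/-- The von Mangoldt function on the integers; it vanishes at integers `k ≤ 0`, which are not
powers of a prime. -/
noncomputable def intVonMangoldt (k : ℤ) : ℝ := ArithmeticFunction.vonMangoldt k.toNat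

/-!
Write `ψ(x) = {x} - 1/2` and `e(t) = exp (2 π i t)`. The number of integers `n` with
`⌊α n + β⌋ = m` is `α⁻¹ + ψ(y - α⁻¹) - ψ(y)` with `y = (β - m) / α`, so up to `O(log N)` boundary
terms the difference of the two sums is a difference of two sums
`∑ Λ(q m + a) ψ(δ - m / α)` (`abs_sum_beatty_sub_le`). Averaging `ψ` over a short window sandwiches
it between difference quotients of the second Bernoulli function, whose Fourier series converges
absolutely (`abs_sum_mul_sawtooth_le`). Hence it suffices to save a power of `N` in the sums
`∑ Λ(q m + a) e(-k m / α)` with `k` and `q` at most a small power of `N`, and detecting the residue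
class by additive characters reduces these to `∑ Λ(n) e(n θ)` with `θ = (b - k / α) / q`
(`norm_sum_vonMangoldt_progression_le`).

Finite type enters as a polynomial lower bound for the distance of `h α` to the nearest integer. It
passes to `α⁻¹` and, with a loss of `q k ^ r`, to `θ`. Vaughan's identity with both cut-offs equal
to a small power `U` of `N` then splits the sum over primes
(`norm_sum_vonMangoldt_mul_unitExp_le`). In the sums with a smooth variable the frequency is `h θ`
with `h ≤ U ^ 2`, and the lower bound for its distance to the integers is enough by itself. In the
bilinear sum the Cauchy-Schwarz inequality with weights `1 / m` and `m` leads to linear sums of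
frequency `h θ` over all `h` in a long range. There no rational approximation to `θ` is needed: by
the lower bound for `h ≤ L`, among `L` consecutive multiples of `θ` at most one is close to an
integer (`sum_le_of_distNearestInt_ge`), which saves a factor `L`. The divisor bound takes care of
the coefficients.
-/

/-! ### Additive characters -/

/-- `unitExp t` is `e(t) = exp (2 π i t)`. -/
noncomputable def unitExp (t : ℝ) : ℂ := Complex.exp (Complex.I * ((2 * Real.pi * t : ℝ) : ℂ))

theorem norm_unitExp (t : ℝ) : ‖unitExp t‖ = 1 := by
  rw [unitExp, mul_comm]; exact Complex.norm_exp_ofReal_mul_I _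

theorem unitExp_add (s t : ℝ) : unitExp (s + t) = unitExp s * unitExp t := by
  rw [unitExp, unitExp, unitExp, ← Complex.exp_add]; congr 1; push_cast; ring

theorem unitExp_zero : unitExp 0 = 1 := by simp [unitExp]

theorem unitExp_eq_one_iff (t : ℝ) : unitExp t = 1 ↔ ∃ n : ℤ, t = n := by
  rw [unitExp, Complex.exp_eq_one_iff]
  refine exists_congr fun n => ?_
  have hpi : (2 * Real.pi * Complex.I : ℂ) ≠ 0 := by
    simp [Real.pi_ne_zero]
  constructor
  · intro h
    have : (2 * Real.pi * Complex.I : ℂ) * (t : ℂ) = (2 * Real.pi * Complex.I : ℂ) * (n : ℂ) := by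
      rw [mul_comm _ (n : ℂ), ← h]; push_cast; ring
    exact_mod_cast mul_left_cancel₀ hpi this
  · rintro rfl; push_cast; ring

theorem unitExp_intCast (n : ℤ) : unitExp n = 1 := (unitExp_eq_one_iff _).2 ⟨n, rfl⟩

theorem unitExp_nat_mul (n : ℕ) (t : ℝ) : unitExp (n * t) = unitExp t ^ n := by
  induction n with
  | zero => simp [unitExp_zero]
  | succ n ih => rw [pow_succ, ← ih, ← unitExp_add]; congr 1; push_cast; ring

theorem conj_unitExp (t : ℝ) : (starRingEnd ℂ) (unitExp t) = unitExp (-t) := by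
  rw [unitExp, unitExp, ← Complex.exp_conj, map_mul, Complex.conj_I, Complex.conj_ofReal]
  congr 1; push_cast; ring

theorem re_unitExp (t : ℝ) : (unitExp t).re = Real.cos (2 * Real.pi * t) := by
  rw [unitExp, mul_comm]; exact Complex.exp_ofReal_mul_I_re _

theorem distNearestInt_nonneg (x : ℝ) : 0 ≤ distNearestInt x := abs_nonneg _

theorem distNearestInt_le (x : ℝ) (n : ℤ) : distNearestInt x ≤ |x - n| := round_le x n

theorem le_distNearestInt {x c : ℝ} (h : ∀ n : ℤ, c ≤ |x - n|) : c ≤ distNearestInt x := h _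

theorem distNearestInt_neg (x : ℝ) : distNearestInt (-x) = distNearestInt x := by
  apply le_antisymm
  · refine le_distNearestInt fun n => (distNearestInt_le _ (-n)).trans (le_of_eq ?_)
    rw [← abs_neg]; congr 1; push_cast; ring
  · refine le_distNearestInt fun n => (distNearestInt_le _ (-n)).trans (le_of_eq ?_)
    rw [← abs_neg]; congr 1; push_cast; ring

theorem distNearestInt_sub_le (x y : ℝ) :
    distNearestInt (x - y) ≤ distNearestInt x + distNearestInt y := by
  refine (distNearestInt_le _ (round x - round y)).trans ?_
  rw [show x - y - ((round x - round y : ℤ) : ℝ) = (x - round x) - (y - round y) by push_cast; ring]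
  exact abs_sub _ _

/-- The chord `|e(φ) - 1| = 2 |sin (π φ)|` dominates the distance of `φ` to the integers. -/
theorem four_mul_distNearestInt_le (φ : ℝ) : 4 * distNearestInt φ ≤ ‖unitExp φ - 1‖ := by
  have h1 : unitExp φ = unitExp (φ - round φ) := by
    conv_lhs => rw [show φ = (φ - round φ) + (round φ : ℤ) by ring, unitExp_add, unitExp_intCast,
      mul_one]
  have h2 : |φ - round φ| ≤ 1 / 2 := abs_sub_round φ
  rw [h1, unitExp, Complex.norm_exp_I_mul_ofReal_sub_one, norm_mul, Real.norm_eq_abs,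
    Real.norm_eq_abs, abs_two, distNearestInt]
  have h3 := Real.mul_abs_le_abs_sin (x := 2 * Real.pi * (φ - round φ) / 2) (by
    rw [show 2 * Real.pi * (φ - round φ) / 2 = Real.pi * (φ - round φ) by ring, abs_mul,
      abs_of_pos Real.pi_pos]
    nlinarith [Real.pi_pos])
  have h4 : 2 / Real.pi * |2 * Real.pi * (φ - round φ) / 2| = 2 * |φ - round φ| := by
    rw [show 2 * Real.pi * (φ - round φ) / 2 = Real.pi * (φ - round φ) by ring, abs_mul,
      abs_of_pos Real.pi_pos]
    field_simp
  linarith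

/-! ### Linear exponential sums -/

/-- Summation by parts in inductive form: multiplying by `e(φ) - 1` makes the sum telescope up to
the variation of the weight. -/
theorem norm_sub_one_mul_sum_le {g : ℕ → ℝ} (hg : Monotone g) (h0 : 0 ≤ g 0) (φ : ℝ) {A B : ℕ}
    (hAB : A ≤ B) :
    ‖(unitExp φ - 1) * ∑ m ∈ Finset.Ioc A B, (g m : ℂ) * unitExp (m * φ)
      - g B * unitExp ((B + 1 : ℕ) * φ)‖ ≤ g B := by
  have hpos : ∀ n, 0 ≤ g n := fun n => h0.trans (hg (Nat.zero_le n))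
  induction B, hAB using Nat.le_induction with
  | base => simp [norm_unitExp, abs_of_nonneg (hpos A)]
  | succ B hB ih =>
    rw [Finset.sum_Ioc_succ_top hB]
    have key : (unitExp φ - 1) * (∑ m ∈ Finset.Ioc A B, (g m : ℂ) * unitExp (m * φ)
          + (g (B + 1) : ℂ) * unitExp ((B + 1 : ℕ) * φ))
        - g (B + 1) * unitExp ((B + 1 + 1 : ℕ) * φ)
        = ((unitExp φ - 1) * ∑ m ∈ Finset.Ioc A B, (g m : ℂ) * unitExp (m * φ)
            - g B * unitExp ((B + 1 : ℕ) * φ))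
          - ((g (B + 1) - g B : ℝ) : ℂ) * unitExp ((B + 1 : ℕ) * φ) := by
      simp only [unitExp_nat_mul]; push_cast; ring
    rw [key]
    refine (norm_sub_le _ _).trans ?_
    rw [norm_mul, norm_unitExp, mul_one, Complex.norm_real, Real.norm_eq_abs,
      abs_of_nonneg (sub_nonneg.2 (hg (Nat.le_succ B)))]
    linarith

theorem norm_sum_mul_unitExp_mul_distNearestInt_le {g : ℕ → ℝ} (hg : Monotone g) (h0 : 0 ≤ g 0)
    (φ : ℝ) (A B : ℕ) :
    ‖∑ m ∈ Finset.Ioc A B, (g m : ℂ) * unitExp (m * φ)‖ * distNearestInt φ ≤ g B := by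
  have hpos : ∀ n, 0 ≤ g n := fun n => h0.trans (hg (Nat.zero_le n))
  rcases le_or_gt A B with hAB | hAB
  · have h1 := norm_sub_one_mul_sum_le hg h0 φ hAB
    set S := ∑ m ∈ Finset.Ioc A B, (g m : ℂ) * unitExp (m * φ)
    have h2 : ‖(unitExp φ - 1) * S‖ ≤ 2 * g B := by
      have := norm_add_le ((unitExp φ - 1) * S - g B * unitExp ((B + 1 : ℕ) * φ))
        (g B * unitExp ((B + 1 : ℕ) * φ))
      rw [sub_add_cancel, norm_mul (g B : ℂ), norm_unitExp, mul_one, Complex.norm_real,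
        Real.norm_eq_abs, abs_of_nonneg (hpos B)] at this
      linarith
    rw [norm_mul] at h2
    have h3 := mul_le_mul_of_nonneg_right (four_mul_distNearestInt_le φ) (norm_nonneg S)
    have h4 := mul_nonneg (norm_nonneg S) (distNearestInt_nonneg φ)
    linarith
  · rw [Finset.Ioc_eq_empty_of_le hAB.le]; simpa using hpos B

/-- If the points `h * θ` with `1 ≤ h ≤ L` stay at distance `δ` from the integers, then in every
block of `L` consecutive `h` at most one point `h * θ` comes within `δ / 2` of an integer. -/
theorem sum_le_of_distNearestInt_ge {θ δ M : ℝ} {L : ℕ} (hL : 0 < L) (hδ : 0 < δ) (hM : 0 ≤ M)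
    (hθ : ∀ h : ℕ, 0 < h → h ≤ L → δ ≤ distNearestInt (h * θ)) (s : ℕ → ℝ)
    (hs : ∀ h, s h ≤ M) (hs' : ∀ h, s h * distNearestInt (h * θ) ≤ 1) (H : ℕ) :
    ∑ h ∈ Finset.range H, s h ≤ (H / L + 1) * M + H * (2 / δ) := by
  classical
  set bad := (Finset.range H).filter fun h : ℕ => distNearestInt (h * θ) < δ / 2 with hbad
  have hcard : bad.card ≤ H / L + 1 := by
    rw [← Finset.card_range (H / L + 1)]
    refine Finset.card_le_card_of_injOn (fun h => h / L) ?_ ?_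
    · intro h hh
      have hh' : h < H := by simpa using (Finset.mem_filter.1 hh).1
      simpa using Nat.lt_succ_of_le (Nat.div_le_div_right hh'.le)
    · have key : ∀ x ∈ bad, ∀ y ∈ bad, x / L = y / L → ¬ x < y := by
        intro x hx y hy hxy hlt
        have hx' := (Finset.mem_filter.1 hx).2
        have hy' := (Finset.mem_filter.1 hy).2
        have hle : y - x ≤ L := by
          have h1 := Nat.div_add_mod x L
          have h2 := Nat.div_add_mod y L
          have h3 := Nat.mod_lt y hL
          rw [hxy] at h1
          omega
        have h1 := hθ (y - x) (by omega) hle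
        rw [Nat.cast_sub hlt.le, sub_mul] at h1
        have h2 := distNearestInt_sub_le (y * θ) (x * θ)
        linarith
      intro x hx y hy hxy
      by_contra hne
      rcases lt_or_gt_of_ne hne with h | h
      · exact key x hx y hy hxy h
      · exact key y hy x hx hxy.symm h
  have hpt : ∀ h ∈ Finset.range H,
      s h ≤ (if distNearestInt (h * θ) < δ / 2 then M else 0) + 2 / δ := by
    intro h _
    split_ifs with hc
    · have := hs h; have : 0 < 2 / δ := by positivity
      linarith [hs h]
    · rw [zero_add, le_div_iff₀ hδ]
      push Not at hc
      rcases le_or_gt 0 (s h) with h0 | h0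
      · have := mul_le_mul_of_nonneg_left hc h0
        have := hs' h
        linarith
      · nlinarith
  refine (Finset.sum_le_sum hpt).trans ?_
  rw [Finset.sum_add_distrib, ← Finset.sum_filter, Finset.sum_const, Finset.sum_const,
    Finset.card_range, nsmul_eq_mul, nsmul_eq_mul]
  have h1 : (bad.card : ℝ) ≤ H / L + 1 := by
    have : ((H / L : ℕ) : ℝ) ≤ (H : ℝ) / L := Nat.cast_div_le
    have h2 : (bad.card : ℝ) ≤ ((H / L : ℕ) : ℝ) + 1 := by exact_mod_cast hcard
    linarith
  gcongr

/-! ### The divisor bound -/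

/-- Prime by prime: `a + 1 ≤ p ^ (a η)` as soon as `p ^ η ≥ 2`, and for the finitely many smaller
primes this holds up to a constant factor. -/
theorem exists_card_divisors_le_rpow {η : ℝ} (hη : 0 < η) :
    ∃ C : ℝ, 1 ≤ C ∧ ∀ n : ℕ, 0 < n → (n.divisors.card : ℝ) ≤ C * (n : ℝ) ^ η := by
  set B : ℝ := 1 + 1 / (η * Real.log 2) with hB
  have hlog : 0 < Real.log 2 := Real.log_pos one_lt_two
  have hB1 : 1 ≤ B := by rw [hB]; have : 0 < 1 / (η * Real.log 2) := by positivity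
                         linarith
  set P : ℕ := ⌈(2 : ℝ) ^ (1 / η)⌉₊ with hP
  refine ⟨B ^ P, one_le_pow₀ hB1, fun n hn => ?_⟩
  have hloc : ∀ p ∈ n.primeFactors, ((n.factorization p + 1 : ℕ) : ℝ)
      ≤ (if p < P then B else 1) * ((p : ℝ) ^ n.factorization p) ^ η := by
    intro p hp
    have hp2 : (2 : ℝ) ≤ p := by exact_mod_cast (Nat.prime_of_mem_primeFactors hp).two_le
    set a := n.factorization p
    have hcomm : ((p : ℝ) ^ a) ^ η = ((p : ℝ) ^ η) ^ a := by
      rw [← Real.rpow_natCast, ← Real.rpow_natCast, ← Real.rpow_mul (by linarith),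
        ← Real.rpow_mul (by linarith), mul_comm]
    split_ifs with h
    · have h1 : 1 + (a : ℝ) * (η * Real.log 2) ≤ ((p : ℝ) ^ a) ^ η := by
        have h2 : ((2 : ℝ) ^ a) ^ η ≤ ((p : ℝ) ^ a) ^ η := by gcongr
        refine le_trans ?_ h2
        rw [← Real.rpow_natCast, ← Real.rpow_mul zero_le_two, Real.rpow_def_of_pos two_pos]
        have := Real.add_one_le_exp (Real.log 2 * (a * η))
        linarith
      have h3 : (1 + 1 / (η * Real.log 2)) * (1 + (a : ℝ) * (η * Real.log 2))
          = 1 + a + (a * (η * Real.log 2) + 1 / (η * Real.log 2)) := by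
        field_simp; ring
      have h4 : 0 ≤ a * (η * Real.log 2) + 1 / (η * Real.log 2) := by positivity
      have h5 := mul_le_mul_of_nonneg_left h1 (by linarith : 0 ≤ B)
      push_cast
      rw [hB] at h5 ⊢
      linarith
    · rw [one_mul, hcomm]
      have h1 : (2 : ℝ) ≤ (p : ℝ) ^ η := by
        have h2 : (2 : ℝ) ^ (1 / η) ≤ p := (Nat.le_ceil _).trans (by exact_mod_cast not_lt.1 h)
        calc (2 : ℝ) = ((2 : ℝ) ^ (1 / η)) ^ η := by
              rw [← Real.rpow_mul zero_le_two, one_div_mul_cancel hη.ne', Real.rpow_one]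
          _ ≤ (p : ℝ) ^ η := by gcongr
      have h2 : ((a + 1 : ℕ) : ℝ) ≤ 2 ^ a := by exact_mod_cast Nat.lt_two_pow_self
      exact h2.trans (by gcongr)
  rw [Nat.card_divisors hn.ne', Nat.cast_prod]
  refine (Finset.prod_le_prod (fun _ _ => Nat.cast_nonneg _) hloc).trans ?_
  rw [Finset.prod_mul_distrib]
  have h1 : ∏ p ∈ n.primeFactors, (if p < P then B else 1) ≤ B ^ P := by
    rw [← Finset.prod_filter, Finset.prod_const]
    refine pow_le_pow_right₀ hB1 ?_
    rw [← Finset.card_range P]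
    refine Finset.card_le_card fun p hp => ?_
    simpa using (Finset.mem_filter.1 hp).2
  have h2 : ∏ p ∈ n.primeFactors, ((p : ℝ) ^ n.factorization p) ^ η = (n : ℝ) ^ η := by
    rw [Real.finsetProd_rpow _ _ (fun _ _ => by positivity)]
    congr 1
    have := Nat.prod_factorization_pow_eq_self hn.ne'
    rw [Finsupp.prod, Nat.support_factorization] at this
    exact_mod_cast this
  rw [h2]
  gcongr

/-! ### Bilinear sums -/

theorem norm_weighted_sum_le (φ : ℝ) (U Y : ℕ) :
    ‖∑ m ∈ Finset.Ioc U Y, (m : ℂ) * unitExp (m * φ)‖ ≤ (Y : ℝ) * Y := by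
  refine (norm_sum_le _ _).trans ?_
  have : ∀ m ∈ Finset.Ioc U Y, ‖(m : ℂ) * unitExp (m * φ)‖ ≤ Y := by
    intro m hm
    rw [norm_mul, norm_unitExp, mul_one, Complex.norm_natCast]
    exact_mod_cast (Finset.mem_Ioc.1 hm).2
  refine (Finset.sum_le_card_nsmul _ _ _ this).trans ?_
  rw [nsmul_eq_mul, Nat.card_Ioc]
  gcongr
  exact Nat.sub_le _ _

theorem sum_range_norm_weighted_sum_le {θ δ : ℝ} {L : ℕ} (hL : 0 < L) (hδ : 0 < δ)
    (hθ : ∀ h : ℕ, 0 < h → h ≤ L → δ ≤ distNearestInt (h * θ)) (U Y H : ℕ) :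
    ∑ h ∈ Finset.range H, ‖∑ m ∈ Finset.Ioc U Y, (m : ℂ) * unitExp (m * (h * θ))‖
      ≤ Y * ((H / L + 1) * Y + H * (2 / δ)) := by
  rcases Nat.eq_zero_or_pos Y with rfl | hY
  · simp
  have hY' : (0 : ℝ) < Y := by exact_mod_cast hY
  have := sum_le_of_distNearestInt_ge (M := (Y : ℝ)) hL hδ hY'.le hθ
    (fun h => (Y : ℝ)⁻¹ * ‖∑ m ∈ Finset.Ioc U Y, (m : ℂ) * unitExp (m * (h * θ))‖)
    (fun h => by
      rw [inv_mul_le_iff₀ hY']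
      exact norm_weighted_sum_le _ _ _)
    (fun h => by
      rw [mul_assoc, inv_mul_le_iff₀ hY', mul_one]
      have := norm_sum_mul_unitExp_mul_distNearestInt_le (g := fun m : ℕ => (m : ℝ))
        Nat.mono_cast (by simp) (h * θ) U Y
      simpa using this) H
  rw [← Finset.mul_sum, inv_mul_le_iff₀ hY'] at this
  exact this

theorem sum_Ioc_inv_le (a b : ℕ) (X : ℕ) (hb : b ≤ X) :
    ∑ k ∈ Finset.Ioc a b, (k : ℝ)⁻¹ ≤ 1 + Real.log X := by
  have h1 := harmonic_le_one_add_log X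
  rw [harmonic_eq_sum_Icc] at h1
  push_cast at h1
  refine le_trans (Finset.sum_le_sum_of_subset_of_nonneg ?_ fun _ _ _ => by positivity) h1
  intro k hk
  rw [Finset.mem_Ioc] at hk
  rw [Finset.mem_Icc]
  omega

theorem sum_Ioc_inv_sq_le (V K : ℕ) (hV : 0 < V) :
    ∑ k ∈ Finset.Ioc V K, ((k : ℝ) ^ 2)⁻¹ ≤ (V : ℝ)⁻¹ := by
  rcases le_or_gt V K with h | h
  · refine (sum_Ioc_inv_sq_le_sub hV.ne' h).trans ?_
    have : (0 : ℝ) ≤ (K : ℝ)⁻¹ := by positivity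
    linarith
  · rw [Finset.Ioc_eq_empty_of_le h.le]; simp

/-- The off-diagonal sum produced by the Cauchy-Schwarz inequality. -/
theorem sum_sum_norm_weighted_sum_le {θ δ : ℝ} {L : ℕ} (hL : 0 < L) (hδ : 0 < δ)
    (hθ : ∀ h : ℕ, 0 < h → h ≤ L → δ ≤ distNearestInt (h * θ)) {U X : ℕ} (hU : 0 < U) :
    ∑ k ∈ Finset.Ioc U (X / U), ∑ l ∈ Finset.Ioc U (X / U),
      ‖∑ m ∈ Finset.Ioc U (X / max k l), (m : ℂ) * unitExp (m * (((k : ℝ) - l) * θ))‖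
      ≤ 2 * (X : ℝ) ^ 2 * ((1 + Real.log X) / L + (U : ℝ)⁻¹ + 2 / (U * δ)) := by
  set K := X / U
  set J : ℕ → ℕ → ℝ := fun k l =>
    ‖∑ m ∈ Finset.Ioc U (X / max k l), (m : ℂ) * unitExp (m * (((k : ℝ) - l) * θ))‖ with hJ
  have hJ0 : ∀ k l, 0 ≤ J k l := fun _ _ => norm_nonneg _
  have hsymm : ∀ k l, J k l = J l k := by
    intro k l
    simp only [hJ]
    rw [← Complex.norm_conj, map_sum, max_comm]
    congr 1
    refine Finset.sum_congr rfl fun m _ => ?_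
    rw [map_mul, conj_unitExp, Complex.conj_natCast]
    congr 2; ring
  have hsplit : ∑ k ∈ Finset.Ioc U K, ∑ l ∈ Finset.Ioc U K, J k l
      ≤ 2 * ∑ k ∈ Finset.Ioc U K, ∑ l ∈ (Finset.Ioc U K).filter (· ≤ k), J k l := by
    have h1 : ∀ k ∈ Finset.Ioc U K, ∑ l ∈ Finset.Ioc U K, J k l
        ≤ ∑ l ∈ (Finset.Ioc U K).filter (· ≤ k), J k l
          + ∑ l ∈ (Finset.Ioc U K).filter (k ≤ ·), J l k := by
      intro k _
      rw [Finset.sum_filter, Finset.sum_filter, ← Finset.sum_add_distrib]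
      refine Finset.sum_le_sum fun l _ => ?_
      rw [hsymm l k]
      have := hJ0 k l
      rcases le_total k l with h | h
      · rw [if_pos h]; split_ifs <;> linarith
      · rw [if_pos h]; split_ifs <;> linarith
    refine (Finset.sum_le_sum h1).trans ?_
    rw [Finset.sum_add_distrib, two_mul]
    apply le_of_eq
    congr 1
    simp only [Finset.sum_filter]
    rw [Finset.sum_comm]
  have hinner : ∀ k ∈ Finset.Ioc U K, ∑ l ∈ (Finset.Ioc U K).filter (· ≤ k), J k l
      ≤ (X : ℝ) ^ 2 * ((k : ℝ)⁻¹ / L + ((k : ℝ) ^ 2)⁻¹) + X * (2 / δ) := by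
    intro k hk
    have hk0 : 0 < k := by have := (Finset.mem_Ioc.1 hk).1; omega
    have hk' : (0 : ℝ) < k := by exact_mod_cast hk0
    have hL' : (0 : ℝ) < L := by exact_mod_cast hL
    have h1 : ∑ l ∈ (Finset.Ioc U K).filter (· ≤ k), J k l ≤ ∑ h ∈ Finset.range k,
        ‖∑ m ∈ Finset.Ioc U (X / k), (m : ℂ) * unitExp (m * (h * θ))‖ := by
      have h2 : ∀ l ∈ (Finset.Ioc U K).filter (· ≤ k), J k l =
          ‖∑ m ∈ Finset.Ioc U (X / k), (m : ℂ) * unitExp (m * (((k - l : ℕ) : ℝ) * θ))‖ := by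
        intro l hl
        have hlk : l ≤ k := (Finset.mem_filter.1 hl).2
        simp only [hJ]
        rw [max_eq_left hlk, Nat.cast_sub hlk]
      rw [Finset.sum_congr rfl h2]
      have hinj : Set.InjOn (fun l => k - l)
          (((Finset.Ioc U K).filter (· ≤ k) : Finset ℕ) : Set ℕ) := by
        intro a ha b hb hab
        have ha' := (Finset.mem_filter.1 ha).2
        have hb' := (Finset.mem_filter.1 hb).2
        simp only at hab
        omega
      rw [← Finset.sum_image (f := fun h : ℕ =>
        ‖∑ m ∈ Finset.Ioc U (X / k), (m : ℂ) * unitExp (m * ((h : ℝ) * θ))‖) hinj]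
      refine Finset.sum_le_sum_of_subset_of_nonneg ?_ fun _ _ _ => norm_nonneg _
      intro h hh
      obtain ⟨l, hl, rfl⟩ := Finset.mem_image.1 hh
      have := (Finset.mem_Ioc.1 (Finset.mem_filter.1 hl).1).1
      rw [Finset.mem_range]
      omega
    refine h1.trans ((sum_range_norm_weighted_sum_le hL hδ hθ U (X / k) k).trans ?_)
    have hY : ((X / k : ℕ) : ℝ) ≤ X / k := Nat.cast_div_le
    calc ((X / k : ℕ) : ℝ) * ((k / L + 1) * ((X / k : ℕ) : ℝ) + k * (2 / δ))
        ≤ (X / k : ℝ) * ((k / L + 1) * (X / k : ℝ) + k * (2 / δ)) := by gcongr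
      _ = (X : ℝ) ^ 2 * ((k : ℝ)⁻¹ / L + ((k : ℝ) ^ 2)⁻¹) + X * (2 / δ) := by
        field_simp
  have hU' : (0 : ℝ) < U := by exact_mod_cast hU
  have hsum := Finset.sum_le_sum hinner
  rw [Finset.sum_add_distrib, ← Finset.mul_sum, Finset.sum_add_distrib, ← Finset.sum_div,
    Finset.sum_const, nsmul_eq_mul, Nat.card_Ioc] at hsum
  have h1 := sum_Ioc_inv_le U K X (Nat.div_le_self _ _)
  have h2 := sum_Ioc_inv_sq_le U K hU
  have h3 : ((K - U : ℕ) : ℝ) ≤ X / U :=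
    (Nat.cast_le.2 (Nat.sub_le _ _)).trans Nat.cast_div_le
  refine hsplit.trans ?_
  calc 2 * ∑ k ∈ Finset.Ioc U K, ∑ l ∈ (Finset.Ioc U K).filter (· ≤ k), J k l
      ≤ 2 * ((X : ℝ) ^ 2 * ((∑ k ∈ Finset.Ioc U K, (k : ℝ)⁻¹) / L
          + ∑ k ∈ Finset.Ioc U K, ((k : ℝ) ^ 2)⁻¹) + ((K - U : ℕ) : ℝ) * (X * (2 / δ))) := by
        gcongr
    _ ≤ 2 * ((X : ℝ) ^ 2 * ((1 + Real.log X) / L + (U : ℝ)⁻¹) + (X / U) * (X * (2 / δ))) := by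
        gcongr
    _ = _ := by field_simp

/-- The sum of squares with weight `m` opens to a double sum over pairs `k, l`. -/
theorem sum_mul_norm_sq_eq (w : ℕ → ℂ) (θ : ℝ) {U X : ℕ} (hU : 0 < U) :
    ((∑ m ∈ Finset.Ioc U X,
        (m : ℝ) * ‖∑ k ∈ Finset.Ioc U (X / m), w k * unitExp (m * (k * θ))‖ ^ 2 : ℝ) : ℂ)
      = ∑ k ∈ Finset.Ioc U (X / U), ∑ l ∈ Finset.Ioc U (X / U),
        w k * (starRingEnd ℂ) (w l) *
          ∑ m ∈ Finset.Ioc U (X / max k l), (m : ℂ) * unitExp (m * (((k : ℝ) - l) * θ)) := by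
  have h1 : ∀ m ∈ Finset.Ioc U X,
      (((m : ℝ) * ‖∑ k ∈ Finset.Ioc U (X / m), w k * unitExp (m * (k * θ))‖ ^ 2 : ℝ) : ℂ)
      = ∑ k ∈ Finset.Ioc U (X / U), ∑ l ∈ Finset.Ioc U (X / U),
        if m ≤ X / max k l then w k * (starRingEnd ℂ) (w l) *
          ((m : ℂ) * unitExp (m * (((k : ℝ) - l) * θ))) else 0 := by
    intro m hm
    rw [Finset.mem_Ioc] at hm
    have hm0 : 0 < m := by omega
    have hsub : Finset.Ioc U (X / m) = (Finset.Ioc U (X / U)).filter (· ≤ X / m) := by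
      ext k
      have : X / m ≤ X / U := Nat.div_le_div_left hm.1.le hU
      simp only [Finset.mem_Ioc, Finset.mem_filter]
      omega
    push_cast
    rw [← Complex.mul_conj', map_sum, Finset.sum_mul_sum, hsub, Finset.sum_filter,
      Finset.mul_sum]
    refine Finset.sum_congr rfl fun k hk => ?_
    have hk0 : 0 < k := by have := (Finset.mem_Ioc.1 hk).1; omega
    have hiff : ∀ l ∈ Finset.Ioc U (X / U), (m ≤ X / max k l ↔ k ≤ X / m ∧ l ≤ X / m) := by
      intro l hl
      have hl0 : 0 < l := by have := (Finset.mem_Ioc.1 hl).1; omega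
      rw [Nat.le_div_iff_mul_le (by omega), Nat.le_div_iff_mul_le hm0, Nat.le_div_iff_mul_le hm0]
      rcases le_total k l with h | h
      · rw [max_eq_right h]
        exact ⟨fun h1 => ⟨by nlinarith, by nlinarith⟩, fun h1 => by nlinarith⟩
      · rw [max_eq_left h]
        exact ⟨fun h1 => ⟨by nlinarith, by nlinarith⟩, fun h1 => by nlinarith⟩
    by_cases hkm : k ≤ X / m
    · rw [if_pos hkm, Finset.sum_filter, Finset.mul_sum]
      refine Finset.sum_congr rfl fun l hl => ?_
      by_cases hlm : l ≤ X / m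
      · rw [if_pos hlm, if_pos ((hiff l hl).2 ⟨hkm, hlm⟩), map_mul, conj_unitExp,
          show (m : ℝ) * (((k : ℝ) - l) * θ) = m * (k * θ) + -(m * (l * θ)) by ring, unitExp_add]
        ring
      · rw [if_neg hlm, if_neg (fun h => hlm ((hiff l hl).1 h).2), mul_zero]
    · rw [if_neg hkm, mul_zero]
      refine (Finset.sum_eq_zero fun l hl => ?_).symm
      rw [if_neg (fun h => hkm ((hiff l hl).1 h).1)]
  rw [Complex.ofReal_sum, Finset.sum_congr rfl h1, Finset.sum_comm]
  refine Finset.sum_congr rfl fun k hk => ?_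
  rw [Finset.sum_comm]
  refine Finset.sum_congr rfl fun l _ => ?_
  rw [← Finset.sum_filter, ← Finset.mul_sum]
  congr 1
  refine Finset.sum_congr ?_ fun _ _ => rfl
  ext m
  have := Nat.div_le_self X (max k l)
  simp only [Finset.mem_Ioc, Finset.mem_filter]
  omega

/-- Cauchy-Schwarz over the outer variable with weights `1 / m` and `m`, followed by the spacing
of the points `h * θ`. With these weights the hyperbolic constraint `m * k ≤ X` costs only a
logarithm, without a dyadic splitting of the ranges. -/
theorem sq_norm_bilinear_sum_le {θ δ A B : ℝ} {L : ℕ} (hL : 0 < L) (hδ : 0 < δ)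
    (hθ : ∀ h : ℕ, 0 < h → h ≤ L → δ ≤ distNearestInt (h * θ)) {U X : ℕ} (hU : 0 < U)
    {a w : ℕ → ℂ} (ha : ∀ m ≤ X, ‖a m‖ ≤ A)
    (hB : 0 ≤ B) (hw : ∀ k, 0 < k → k ≤ X → ‖w k‖ ≤ B) :
    ‖∑ m ∈ Finset.Ioc U X, a m * ∑ k ∈ Finset.Ioc U (X / m), w k * unitExp (m * (k * θ))‖ ^ 2
      ≤ A ^ 2 * (1 + Real.log X) * (B ^ 2 *
        (2 * (X : ℝ) ^ 2 * ((1 + Real.log X) / L + (U : ℝ)⁻¹ + 2 / (U * δ)))) := by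
  set I : ℕ → ℂ := fun m => ∑ k ∈ Finset.Ioc U (X / m), w k * unitExp (m * (k * θ)) with hI
  have hlog : 0 ≤ Real.log X := Real.log_natCast_nonneg X
  have h1 : ‖∑ m ∈ Finset.Ioc U X, a m * I m‖ ≤ A * ∑ m ∈ Finset.Ioc U X, ‖I m‖ := by
    refine (norm_sum_le _ _).trans ?_
    rw [Finset.mul_sum]
    refine Finset.sum_le_sum fun m hm => ?_
    rw [norm_mul]
    exact mul_le_mul_of_nonneg_right (ha m (Finset.mem_Ioc.1 hm).2) (norm_nonneg _)
  have h2 : (∑ m ∈ Finset.Ioc U X, ‖I m‖) ^ 2 ≤ (∑ m ∈ Finset.Ioc U X, (m : ℝ)⁻¹) *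
      ∑ m ∈ Finset.Ioc U X, (m : ℝ) * ‖I m‖ ^ 2 := by
    refine Finset.sum_sq_le_sum_mul_sum_of_sq_le_mul _ (fun m _ => by positivity)
      (fun m _ => by positivity) fun m hm => ?_
    have : (m : ℝ) ≠ 0 := by
      have := (Finset.mem_Ioc.1 hm).1
      exact_mod_cast (by omega : m ≠ 0)
    apply le_of_eq
    field_simp
  have h3 : ∑ m ∈ Finset.Ioc U X, (m : ℝ) * ‖I m‖ ^ 2 ≤ B ^ 2 *
      (2 * (X : ℝ) ^ 2 * ((1 + Real.log X) / L + (U : ℝ)⁻¹ + 2 / (U * δ))) := by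
    have h4 : ∑ m ∈ Finset.Ioc U X, (m : ℝ) * ‖I m‖ ^ 2 =
        ‖((∑ m ∈ Finset.Ioc U X, (m : ℝ) * ‖I m‖ ^ 2 : ℝ) : ℂ)‖ := by
      rw [Complex.norm_real, Real.norm_eq_abs, abs_of_nonneg]
      exact Finset.sum_nonneg fun m _ => by positivity
    rw [h4, hI, sum_mul_norm_sq_eq w θ hU]
    refine le_trans ?_ (mul_le_mul_of_nonneg_left
      (sum_sum_norm_weighted_sum_le hL hδ hθ hU (X := X)) (sq_nonneg B))
    refine (norm_sum_le _ _).trans ?_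
    rw [Finset.mul_sum]
    refine Finset.sum_le_sum fun k hk => (norm_sum_le _ _).trans ?_
    rw [Finset.mul_sum]
    refine Finset.sum_le_sum fun l hl => ?_
    rw [norm_mul, norm_mul, RCLike.norm_conj, sq]
    have hXU := Nat.div_le_self X U
    rw [Finset.mem_Ioc] at hk hl
    gcongr
    · exact hw k (by omega) (by omega)
    · exact hw l (by omega) (by omega)
  have hA : 0 ≤ A := (norm_nonneg _).trans (ha 0 (Nat.zero_le _))
  calc _ ≤ (A * ∑ m ∈ Finset.Ioc U X, ‖I m‖) ^ 2 := by gcongr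
    _ = A ^ 2 * (∑ m ∈ Finset.Ioc U X, ‖I m‖) ^ 2 := by ring
    _ ≤ A ^ 2 * ((1 + Real.log X) * (B ^ 2 *
        (2 * (X : ℝ) ^ 2 * ((1 + Real.log X) / L + (U : ℝ)⁻¹ + 2 / (U * δ))))) := by
      refine mul_le_mul_of_nonneg_left (h2.trans ?_) (sq_nonneg A)
      exact mul_le_mul (sum_Ioc_inv_le U X X le_rfl) h3
        (Finset.sum_nonneg fun m _ => by positivity) (by linarith)
    _ = _ := by ring

/-! ### Vaughan's identity -/

open scoped ArithmeticFunction.zeta in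
/-- Vaughan's identity for arbitrary splittings `Λ = Λ₁ + Λ₂` and `μ = μ₁ + μ₂`. -/
theorem vonMangoldt_eq_vaughan {Λ₁ Λ₂ μ₁ μ₂ : ArithmeticFunction ℝ}
    (hΛ : ArithmeticFunction.vonMangoldt = Λ₁ + Λ₂)
    (hμ : ((ArithmeticFunction.moebius : ArithmeticFunction ℤ) : ArithmeticFunction ℝ) = μ₁ + μ₂) :
    ArithmeticFunction.vonMangoldt = Λ₁ + μ₁ * ArithmeticFunction.log
      - μ₁ * (Λ₁ * (ζ : ArithmeticFunction ℝ)) + Λ₂ * (μ₂ * (ζ : ArithmeticFunction ℝ)) := by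
  have h1 := ArithmeticFunction.vonMangoldt_mul_zeta
  have h2 := ArithmeticFunction.coe_moebius_mul_coe_zeta (R := ℝ)
  have h3 : Λ₂ = ArithmeticFunction.vonMangoldt - Λ₁ := by rw [hΛ]; ring
  have h4 : μ₂ =
      ((ArithmeticFunction.moebius : ArithmeticFunction ℤ) : ArithmeticFunction ℝ) - μ₁ := by
    rw [hμ]; ring
  rw [← h1, h3, h4]
  linear_combination (Λ₁ - ArithmeticFunction.vonMangoldt) * h2

/-- The restriction of an arithmetic function to arguments satisfying `p`. -/
def ArithmeticFunction.restrict (f : ArithmeticFunction ℝ) (p : ℕ → Prop) [DecidablePred p] :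
    ArithmeticFunction ℝ :=
  ⟨fun n => if p n then f n else 0, by simp⟩

theorem ArithmeticFunction.restrict_apply (f : ArithmeticFunction ℝ) (p : ℕ → Prop)
    [DecidablePred p] (n : ℕ) : f.restrict p n = if p n then f n else 0 := rfl

theorem ArithmeticFunction.restrict_add_restrict_not (f : ArithmeticFunction ℝ) (p : ℕ → Prop)
    [DecidablePred p] : f = f.restrict p + f.restrict fun n => ¬ p n := by
  ext n
  rw [ArithmeticFunction.add_apply, restrict_apply, restrict_apply]
  by_cases h : p n <;> simp [h]

/-- A Dirichlet convolution summed against an arbitrary weight. -/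
theorem sum_Ioc_mul_weight (f g : ArithmeticFunction ℝ) (z : ℕ → ℂ) (N : ℕ) :
    ∑ n ∈ Finset.Ioc 0 N, (((f * g) n : ℝ) : ℂ) * z n
      = ∑ d ∈ Finset.Ioc 0 N, (f d : ℂ) * ∑ m ∈ Finset.Ioc 0 (N / d), (g m : ℂ) * z (d * m) := by
  have h1 : ∀ n ∈ Finset.Ioc 0 N, (((f * g) n : ℝ) : ℂ) * z n
      = ∑ x ∈ Finset.Ioc 0 N ×ˢ Finset.Ioc 0 N with x.1 * x.2 = n,
        (f x.1 : ℂ) * g x.2 * z (x.1 * x.2) := by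
    intro n hn
    rw [Finset.mem_Ioc] at hn
    rw [ArithmeticFunction.mul_apply, Nat.divisorsAntidiagonal_eq_prod_filter_of_le hn.1.ne' hn.2]
    push_cast
    rw [Finset.sum_mul]
    refine Finset.sum_congr rfl fun x hx => ?_
    rw [(Finset.mem_filter.1 hx).2]
  rw [Finset.sum_congr rfl h1]
  simp_rw [Finset.sum_filter]
  rw [Finset.sum_comm, Finset.sum_product]
  refine Finset.sum_congr rfl fun d hd => ?_
  rw [Finset.mem_Ioc] at hd
  rw [Finset.mul_sum]
  have hsub : Finset.Ioc 0 (N / d) = (Finset.Ioc 0 N).filter (fun m => d * m ≤ N) := by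
    ext m
    have h1 := Nat.div_le_self N d
    have h2 : m ≤ N / d ↔ d * m ≤ N := by rw [Nat.le_div_iff_mul_le hd.1, mul_comm]
    simp only [Finset.mem_Ioc, Finset.mem_filter, ← h2]
    omega
  rw [hsub, Finset.sum_filter]
  refine Finset.sum_congr rfl fun m hm => ?_
  rw [Finset.mem_Ioc] at hm
  rw [Finset.sum_ite_eq]
  have : d * m ∈ Finset.Ioc 0 N ↔ d * m ≤ N := by
    rw [Finset.mem_Ioc]
    exact ⟨fun h => h.2, fun h => ⟨Nat.mul_pos hd.1 hm.1, h⟩⟩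
  simp only [this]
  split_ifs <;> ring

open scoped ArithmeticFunction.zeta in
theorem abs_mul_zeta_le_card_divisors {f : ArithmeticFunction ℝ} (hf : ∀ n, |f n| ≤ 1) (n : ℕ) :
    |(f * (ζ : ArithmeticFunction ℝ)) n| ≤ n.divisors.card := by
  rw [ArithmeticFunction.coe_mul_zeta_apply]
  refine (Finset.abs_sum_le_sum_abs _ _).trans ?_
  refine (Finset.sum_le_card_nsmul _ _ 1 fun i _ => hf i).trans (by simp)

/-! ### Exponential sums over primes -/

section Vaughan

open scoped ArithmeticFunction.zeta

theorem norm_sum_restrict_mul_le {f : ArithmeticFunction ℝ} {A D : ℝ} {U N : ℕ} {I : ℕ → ℂ}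
    (hA : 0 ≤ A) (hD : 0 ≤ D) (hf : ∀ d, 0 < d → d ≤ N → |f d| ≤ A)
    (hI : ∀ d, 0 < d → d ≤ U → ‖I d‖ ≤ D) :
    ‖∑ d ∈ Finset.Ioc 0 N, ((f.restrict (· ≤ U) d : ℝ) : ℂ) * I d‖ ≤ U * (A * D) := by
  have h1 : ∑ d ∈ Finset.Ioc 0 N, ((f.restrict (· ≤ U) d : ℝ) : ℂ) * I d
      = ∑ d ∈ (Finset.Ioc 0 N).filter (· ≤ U), (f d : ℂ) * I d := by
    rw [Finset.sum_filter]
    refine Finset.sum_congr rfl fun d _ => ?_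
    rw [ArithmeticFunction.restrict_apply]
    split_ifs <;> simp
  have h2 : ∀ d ∈ (Finset.Ioc 0 N).filter (· ≤ U), ‖(f d : ℂ) * I d‖ ≤ A * D := by
    intro d hd
    rw [Finset.mem_filter, Finset.mem_Ioc] at hd
    rw [norm_mul, Complex.norm_real, Real.norm_eq_abs]
    exact mul_le_mul (hf d hd.1.1 hd.1.2) (hI d hd.1.1 hd.2) (norm_nonneg _) hA
  rw [h1]
  refine (norm_sum_le _ _).trans ((Finset.sum_le_card_nsmul _ _ _ h2).trans ?_)
  rw [nsmul_eq_mul]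
  have h3 : ((Finset.Ioc 0 N).filter (· ≤ U)).card ≤ U := by
    calc _ ≤ (Finset.Ioc 0 U).card := Finset.card_le_card fun d hd => by
            rw [Finset.mem_filter, Finset.mem_Ioc] at hd
            rw [Finset.mem_Ioc]; exact ⟨hd.1.1, hd.2⟩
      _ = U := by simp
  have : (0 : ℝ) ≤ A * D := mul_nonneg hA hD
  gcongr

theorem norm_sum_mul_unitExp_le_div {g : ℕ → ℝ} (hg : Monotone g) (h0 : 0 ≤ g 0) {φ δ : ℝ}
    (hδ : 0 < δ) (hφ : δ ≤ distNearestInt φ) (B : ℕ) :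
    ‖∑ m ∈ Finset.Ioc 0 B, (g m : ℂ) * unitExp (m * φ)‖ ≤ g B / δ := by
  rw [le_div_iff₀ hδ]
  exact (mul_le_mul_of_nonneg_left hφ (norm_nonneg _)).trans
    (norm_sum_mul_unitExp_mul_distNearestInt_le hg h0 φ 0 B)

theorem monotone_log_natCast : Monotone fun n : ℕ => Real.log n := by
  intro a b hab
  rcases Nat.eq_zero_or_pos a with rfl | ha
  · simpa using Real.log_natCast_nonneg b
  · exact Real.log_le_log (by exact_mod_cast ha) (by exact_mod_cast hab)

/-- Vaughan's identity with both cut-offs equal to `U`. The two sums with a smooth variable only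
see the distances of `h * θ` to the integers for `h ≤ U ^ 2`; the bilinear sum sees those with
`h ≤ L`. -/
theorem norm_sum_vonMangoldt_mul_unitExp_le {θ δ δ' B : ℝ} {L U X : ℕ} (hL : 0 < L) (hU : 0 < U)
    (hUX : U ≤ X) (hδ : 0 < δ) (hδ' : 0 < δ') (hδ'1 : δ' ≤ 1)
    (hθ : ∀ h : ℕ, 0 < h → h ≤ L → δ ≤ distNearestInt (h * θ))
    (hθ' : ∀ h : ℕ, 0 < h → h ≤ U ^ 2 → δ' ≤ distNearestInt (h * θ))
    (hB : ∀ n : ℕ, 0 < n → n ≤ X → (n.divisors.card : ℝ) ≤ B) :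
    ‖∑ n ∈ Finset.Ioc 0 X, (ArithmeticFunction.vonMangoldt n : ℂ) * unitExp (n * θ)‖
      ≤ 3 * U ^ 2 * Real.log X / δ' + Real.log X * B * X *
        Real.sqrt (2 * (1 + Real.log X) *
          ((1 + Real.log X) / L + (U : ℝ)⁻¹ + 2 / (U * δ))) := by
  set Λ : ArithmeticFunction ℝ := ArithmeticFunction.vonMangoldt with hΛ
  set μ : ArithmeticFunction ℝ :=
    ((ArithmeticFunction.moebius : ArithmeticFunction ℤ) : ArithmeticFunction ℝ) with hμ
  set z : ℕ → ℂ := fun n => unitExp (n * θ) with hz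
  have hzm : ∀ a b : ℕ, z (a * b) = unitExp (b * (a * θ)) := by
    intro a b; simp only [hz]; congr 1; push_cast; ring
  have hlog : 0 ≤ Real.log X := Real.log_natCast_nonneg X
  have hU1 : (1 : ℝ) ≤ U := by exact_mod_cast hU
  have hμ1 : ∀ n, |μ n| ≤ 1 := by
    intro n
    rw [hμ, ArithmeticFunction.intCoe_apply]
    exact_mod_cast ArithmeticFunction.abs_moebius_le_one
  have hΛ1 : ∀ n, n ≤ X → |Λ n| ≤ Real.log X := by
    intro n hn
    rw [abs_of_nonneg ArithmeticFunction.vonMangoldt_nonneg]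
    exact ArithmeticFunction.vonMangoldt_le_log.trans (monotone_log_natCast hn)
  have hB0 : 0 ≤ B := (Nat.cast_nonneg _).trans (hB 1 one_pos (by omega))
  have key := vonMangoldt_eq_vaughan (Λ.restrict_add_restrict_not (· ≤ U))
    (μ.restrict_add_restrict_not (· ≤ U))
  have hsum : ∑ n ∈ Finset.Ioc 0 X, (Λ n : ℂ) * z n
      = ∑ n ∈ Finset.Ioc 0 X, ((Λ.restrict (· ≤ U) n : ℝ) : ℂ) * z n
        + ∑ n ∈ Finset.Ioc 0 X, (((μ.restrict (· ≤ U) * ArithmeticFunction.log) n : ℝ) : ℂ) * z n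
        - ∑ n ∈ Finset.Ioc 0 X, (((μ.restrict (· ≤ U) * (Λ.restrict (· ≤ U)
            * (ζ : ArithmeticFunction ℝ))) n : ℝ) : ℂ) * z n
        + ∑ n ∈ Finset.Ioc 0 X, (((Λ.restrict (fun n => ¬ n ≤ U) *
            (μ.restrict (fun n => ¬ n ≤ U) * (ζ : ArithmeticFunction ℝ))) n : ℝ) : ℂ) * z n := by
    rw [← Finset.sum_add_distrib, ← Finset.sum_sub_distrib, ← Finset.sum_add_distrib]
    refine Finset.sum_congr rfl fun n _ => ?_
    conv_lhs => rw [hΛ, key]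
    rw [ArithmeticFunction.add_apply, sub_eq_add_neg, ArithmeticFunction.add_apply,
      ArithmeticFunction.add_apply, ArithmeticFunction.neg_apply]
    push_cast
    ring
  have e1 : ‖∑ n ∈ Finset.Ioc 0 X, ((Λ.restrict (· ≤ U) n : ℝ) : ℂ) * z n‖
      ≤ U * (Real.log X * 1) :=
    norm_sum_restrict_mul_le hlog zero_le_one (fun d _ hd => hΛ1 d hd)
      fun d _ _ => (norm_unitExp _).le
  have e2 : ‖∑ n ∈ Finset.Ioc 0 X,
      (((μ.restrict (· ≤ U) * ArithmeticFunction.log) n : ℝ) : ℂ) * z n‖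
      ≤ U * (1 * (Real.log X / δ')) := by
    rw [sum_Ioc_mul_weight]
    refine norm_sum_restrict_mul_le zero_le_one (by positivity) (fun d _ _ => hμ1 d)
      fun d hd hdU => ?_
    simp only [hzm, ArithmeticFunction.log_apply]
    refine (norm_sum_mul_unitExp_le_div monotone_log_natCast (by simp) hδ'
      (hθ' d hd (hdU.trans (by nlinarith))) _).trans ?_
    exact div_le_div_of_nonneg_right (monotone_log_natCast (Nat.div_le_self X d)) hδ'.le
  have e3 : ‖∑ n ∈ Finset.Ioc 0 X, (((μ.restrict (· ≤ U) * (Λ.restrict (· ≤ U)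
      * (ζ : ArithmeticFunction ℝ))) n : ℝ) : ℂ) * z n‖
      ≤ U * (1 * (U * (Real.log X * (1 / δ')))) := by
    rw [sum_Ioc_mul_weight]
    refine norm_sum_restrict_mul_le zero_le_one (by positivity) (fun d _ _ => hμ1 d)
      fun d hd hdU => ?_
    rw [sum_Ioc_mul_weight _ _ fun n => z (d * n)]
    refine norm_sum_restrict_mul_le hlog (by positivity)
      (fun c _ hc => hΛ1 c (hc.trans (Nat.div_le_self _ _))) fun c hc hcU => ?_
    have h1 := norm_sum_mul_unitExp_le_div (g := fun _ => 1) monotone_const zero_le_one hδ'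
      (hθ' (d * c) (Nat.mul_pos hd hc) (by rw [sq]; exact Nat.mul_le_mul hdU hcU)) (X / d / c)
    refine le_trans (le_of_eq ?_) h1
    congr 1
    refine Finset.sum_congr rfl fun m hm => ?_
    have hm0 : m ≠ 0 := by have := (Finset.mem_Ioc.1 hm).1; omega
    rw [← mul_assoc, hzm, ArithmeticFunction.natCoe_apply, ArithmeticFunction.zeta_apply,
      if_neg hm0]
    simp
  have e4 : ‖∑ n ∈ Finset.Ioc 0 X, (((Λ.restrict (fun n => ¬ n ≤ U) *
      (μ.restrict (fun n => ¬ n ≤ U) * (ζ : ArithmeticFunction ℝ))) n : ℝ) : ℂ) * z n‖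
      ≤ Real.log X * B * X * Real.sqrt (2 * (1 + Real.log X) *
          ((1 + Real.log X) / L + (U : ℝ)⁻¹ + 2 / (U * δ))) := by
    set w : ArithmeticFunction ℝ := μ.restrict (fun n => ¬ n ≤ U) * (ζ : ArithmeticFunction ℝ)
      with hw
    have hwB : ∀ k, 0 < k → k ≤ X → ‖(w k : ℂ)‖ ≤ B := by
      intro k hk hkX
      rw [Complex.norm_real, Real.norm_eq_abs]
      refine (abs_mul_zeta_le_card_divisors (fun n => ?_) k).trans (hB k hk hkX)
      rw [ArithmeticFunction.restrict_apply]
      split_ifs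
      · simp
      · exact hμ1 n
    have hw0 : ∀ k, k ≤ U → w k = 0 := by
      intro k hk
      rw [hw, ArithmeticFunction.coe_mul_zeta_apply]
      refine Finset.sum_eq_zero fun i hi => ?_
      rw [ArithmeticFunction.restrict_apply, if_neg]
      exact not_not.2 ((Nat.divisor_le hi).trans hk)
    have h1 : ∑ n ∈ Finset.Ioc 0 X, (((Λ.restrict (fun n => ¬ n ≤ U) * w) n : ℝ) : ℂ) * z n
        = ∑ m ∈ Finset.Ioc U X, (Λ m : ℂ) *
          ∑ k ∈ Finset.Ioc U (X / m), (w k : ℂ) * unitExp (m * (k * θ)) := by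
      rw [sum_Ioc_mul_weight]
      symm
      refine Finset.sum_subset_zero_on_sdiff (Finset.Ioc_subset_Ioc_left (Nat.zero_le _)) ?_ ?_
      · intro m hm
        rw [Finset.mem_sdiff, Finset.mem_Ioc, Finset.mem_Ioc] at hm
        rw [ArithmeticFunction.restrict_apply, if_neg (by omega)]
        simp
      · intro m hm
        rw [Finset.mem_Ioc] at hm
        rw [ArithmeticFunction.restrict_apply, if_pos (by omega)]
        congr 1
        refine Finset.sum_subset_zero_on_sdiff (Finset.Ioc_subset_Ioc_left (Nat.zero_le _)) ?_ ?_
        · intro k hk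
          rw [Finset.mem_sdiff, Finset.mem_Ioc, Finset.mem_Ioc] at hk
          rw [hw0 k (by omega)]
          simp
        · intro k _
          rw [mul_comm m k, hzm]
    rw [h1]
    have h2 := sq_norm_bilinear_sum_le hL hδ hθ hU (X := X) (a := fun m => (Λ m : ℂ))
      (w := fun k => (w k : ℂ)) (A := Real.log X)
      (fun m hm => by rw [Complex.norm_real, Real.norm_eq_abs]; exact hΛ1 m hm) hB0 hwB
    refine (Real.le_sqrt_of_sq_le h2).trans (le_of_eq ?_)
    rw [show Real.log X ^ 2 * (1 + Real.log X) * (B ^ 2 * (2 * (X : ℝ) ^ 2 *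
        ((1 + Real.log X) / L + (U : ℝ)⁻¹ + 2 / (U * δ)))) = (Real.log X * B * X) ^ 2 *
        (2 * (1 + Real.log X) * ((1 + Real.log X) / L + (U : ℝ)⁻¹ + 2 / (U * δ))) by ring,
      Real.sqrt_mul (sq_nonneg _), Real.sqrt_sq (by positivity)]
  have hδinv : 1 ≤ 1 / δ' := by rw [le_div_iff₀ hδ']; linarith
  have e5 : U * (Real.log X * 1) + U * (1 * (Real.log X / δ'))
      + U * (1 * (U * (Real.log X * (1 / δ')))) ≤ 3 * U ^ 2 * Real.log X / δ' := by
    have hx : 0 ≤ Real.log X * (1 / δ') := by positivity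
    have h1 : U * (Real.log X * 1) ≤ U * (Real.log X * (1 / δ')) := by gcongr
    have h2 : U * (Real.log X * (1 / δ')) ≤ U * (U * (Real.log X * (1 / δ'))) := by
      have : Real.log X * (1 / δ') ≤ U * (Real.log X * (1 / δ')) := le_mul_of_one_le_left hx hU1
      gcongr
    have h3 : 3 * U ^ 2 * Real.log X / δ' = 3 * (U * (U * (Real.log X * (1 / δ')))) := by
      ring
    have h4 : U * (1 * (Real.log X / δ')) = U * (Real.log X * (1 / δ')) := by ring
    rw [h3, h4]
    linarith
  rw [hsum]
  refine (norm_add_le _ _).trans (add_le_add (((norm_sub_le _ _).trans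
    (add_le_add ((norm_add_le _ _).trans (add_le_add e1 e2)) e3)).trans e5) e4)

end Vaughan

theorem log_le_rpow_of_one_le {η : ℝ} (hη : 0 < η) {x : ℝ} (hx : 1 ≤ x) :
    1 + Real.log x ≤ (1 + 1 / η) * x ^ η := by
  have h1 := Real.log_le_rpow_div (zero_le_one.trans hx) hη
  have h2 : 1 ≤ x ^ η := Real.one_le_rpow hx hη.le
  have h3 : (1 + 1 / η) * x ^ η = x ^ η + x ^ η / η := by ring
  linarith

/-- The prime exponential sum for a frequency whose multiples `h * θ` avoid the integers
polynomially, in terms of a parameter `Y` that is a small power of `X`. The choices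
`L = Y ^ 2` and `U = Y ^ (4 * r + 4)` make each error term a saving of a factor `Y`. -/
theorem exists_norm_sum_vonMangoldt_le (r : ℕ) {c η : ℝ} (hc : 0 < c) (hc1 : c ≤ 1) (hη : 0 < η) :
    ∃ C : ℝ, 0 < C ∧ ∀ (X Y : ℕ) (θ : ℝ), 0 < Y → Y ^ (4 * (4 * r ^ 2 + 9 * r + 5)) ≤ X →
      (∀ h : ℕ, 0 < h → c ≤ (Y : ℝ) ^ (2 * r + 2) * (h : ℝ) ^ r * distNearestInt (h * θ)) →
      ‖∑ n ∈ Finset.Ioc 0 X, (ArithmeticFunction.vonMangoldt n : ℂ) * unitExp (n * θ)‖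
        ≤ C * (X : ℝ) ^ η * X / Y := by
  obtain ⟨D, hD1, hD⟩ := exists_card_divisors_le_rpow (η := η / 3) (by positivity)
  set c₁ : ℝ := 1 + 1 / (η / 3) with hc₁
  have hc₁0 : 1 ≤ c₁ := by
    have : 0 < 1 / (η / 3) := by positivity
    linarith
  refine ⟨3 * c₁ / c + 3 * c₁ ^ 2 * D / c, by positivity, fun X Y θ hY hYX hθ => ?_⟩
  have hX : 1 ≤ X := (Nat.one_le_pow _ _ hY).trans hYX
  have hX' : (1 : ℝ) ≤ X := by exact_mod_cast hX
  have hY' : (1 : ℝ) ≤ Y := by exact_mod_cast hY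
  have hY0 : (0 : ℝ) < Y := by linarith
  set E : ℝ := (X : ℝ) ^ (η / 3) with hE
  have hE1 : 1 ≤ E := Real.one_le_rpow hX' (by positivity)
  have hE3 : (X : ℝ) ^ η = E ^ 3 := by
    rw [hE, ← Real.rpow_natCast, ← Real.rpow_mul (by linarith)]
    congr 1; push_cast; ring
  have hlogE : 1 + Real.log X ≤ c₁ * E := log_le_rpow_of_one_le (by positivity) hX'
  have hlog0 : 0 ≤ Real.log X := Real.log_natCast_nonneg X
  have hdist : ∀ (t : ℕ) (h : ℕ), 0 < h → h ≤ Y ^ t →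
      c / (Y : ℝ) ^ (2 * r + 2 + t * r) ≤ distNearestInt (h * θ) := by
    intro t h hh hht
    rw [div_le_iff₀ (by positivity)]
    refine (hθ h hh).trans ?_
    have h1 : (h : ℝ) ^ r ≤ (Y : ℝ) ^ (t * r) := by
      rw [pow_mul]
      have : (h : ℝ) ≤ (Y : ℝ) ^ t := by exact_mod_cast hht
      gcongr
    have h2 := distNearestInt_nonneg (h * θ)
    rw [pow_add _ (2 * r + 2), mul_comm (distNearestInt _)]
    exact mul_le_mul_of_nonneg_right (mul_le_mul_of_nonneg_left h1 (by positivity)) h2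
  have main := norm_sum_vonMangoldt_mul_unitExp_le (θ := θ)
    (δ := c / (Y : ℝ) ^ (2 * r + 2 + 2 * r))
    (δ' := c / (Y : ℝ) ^ (2 * r + 2 + ((4 * r + 4) * 2) * r)) (B := D * E) (L := Y ^ 2)
    (U := Y ^ (4 * r + 4)) (X := X) (by positivity) (by positivity)
    ((Nat.pow_le_pow_right hY (by nlinarith)).trans hYX) (by positivity) (by positivity)
    (by rw [div_le_one (by positivity)]; exact hc1.trans (one_le_pow₀ hY'))
    (hdist 2) (fun h hh hhU => hdist _ h hh (by rw [pow_mul]; exact hhU))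
    (fun n hn hnX => (hD n hn).trans (by
      rw [hE]
      have : (n : ℝ) ≤ X := by exact_mod_cast hnX
      gcongr))
  refine main.trans ?_
  have t1 : 3 * ((Y ^ (4 * r + 4) : ℕ) : ℝ) ^ 2 * Real.log X /
      (c / (Y : ℝ) ^ (2 * r + 2 + ((4 * r + 4) * 2) * r)) ≤ 3 * c₁ / c * E ^ 3 * X / Y := by
    -- `U ^ 2 / δ'` is a constant times this power of `Y`
    have h1 : (Y : ℝ) ^ (2 * (4 * r ^ 2 + 9 * r + 5)) ≤ X / Y := by
      rw [le_div_iff₀ hY0, ← pow_succ]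
      refine le_trans ?_ (by exact_mod_cast hYX : (Y : ℝ) ^ (4 * (4 * r ^ 2 + 9 * r + 5)) ≤ X)
      exact pow_le_pow_right₀ hY' (by nlinarith)
    have h2 : 3 * ((Y ^ (4 * r + 4) : ℕ) : ℝ) ^ 2 * Real.log X /
        (c / (Y : ℝ) ^ (2 * r + 2 + ((4 * r + 4) * 2) * r))
        = 3 / c * Real.log X * (Y : ℝ) ^ (2 * (4 * r ^ 2 + 9 * r + 5)) := by
      have : (Y : ℝ) ^ (2 * (4 * r ^ 2 + 9 * r + 5))
          = ((Y : ℝ) ^ (4 * r + 4)) ^ 2 * (Y : ℝ) ^ (2 * r + 2 + ((4 * r + 4) * 2) * r) := by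
        rw [← pow_mul, ← pow_add]; congr 1; ring
      rw [this]
      push_cast
      field_simp
    rw [h2]
    have h3 : Real.log X ≤ c₁ * E ^ 3 := by
      have : E ≤ E ^ 3 := le_self_pow₀ hE1 (by norm_num)
      nlinarith
    calc _ ≤ 3 / c * (c₁ * E ^ 3) * (X / Y) := by gcongr
      _ = _ := by ring
  have t2 : Real.log X * (D * E) * X * Real.sqrt (2 * (1 + Real.log X) *
      ((1 + Real.log X) / (Y ^ 2 : ℕ) + ((Y ^ (4 * r + 4) : ℕ) : ℝ)⁻¹
        + 2 / ((Y ^ (4 * r + 4) : ℕ) * (c / (Y : ℝ) ^ (2 * r + 2 + 2 * r)))))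
      ≤ 3 * c₁ ^ 2 * D / c * E ^ 3 * X / Y := by
    have h1 : ((Y ^ (4 * r + 4) : ℕ) : ℝ) * (c / (Y : ℝ) ^ (2 * r + 2 + 2 * r)) = c * Y ^ 2 := by
      rw [show 4 * r + 4 = (2 * r + 2 + 2 * r) + 2 by ring, pow_add]
      push_cast
      field_simp
    have h2 : ((Y ^ (4 * r + 4) : ℕ) : ℝ)⁻¹ ≤ 1 / (Y : ℝ) ^ 2 := by
      rw [← one_div]
      push_cast
      exact one_div_le_one_div_of_le (by positivity) (pow_le_pow_right₀ hY' (by omega))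
    have h3 : Real.sqrt (2 * (1 + Real.log X) *
      ((1 + Real.log X) / (Y ^ 2 : ℕ) + ((Y ^ (4 * r + 4) : ℕ) : ℝ)⁻¹
        + 2 / ((Y ^ (4 * r + 4) : ℕ) * (c / (Y : ℝ) ^ (2 * r + 2 + 2 * r)))))
        ≤ c₁ * E * (3 / (c * Y)) := by
      rw [h1]
      apply Real.sqrt_le_iff.2 ⟨by positivity, ?_⟩
      have hl1 : 1 ≤ 1 + Real.log X := by linarith
      have hc' : 1 ≤ 1 / c := by rw [le_div_iff₀ hc]; linarith
      have hc2 : 1 / c ≤ 1 / c * (1 / c) := by nlinarith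
      have h4 : (1 + Real.log X) / (Y ^ 2 : ℕ) + ((Y ^ (4 * r + 4) : ℕ) : ℝ)⁻¹
          + 2 / (c * (Y : ℝ) ^ 2)
          ≤ (1 + Real.log X) * (4 * (1 / c * (1 / c)) * (1 / (Y : ℝ) ^ 2)) := by
        have e1 : (1 + Real.log X) / (Y ^ 2 : ℕ) = (1 + Real.log X) * (1 * (1 / (Y : ℝ) ^ 2)) := by
          push_cast; ring
        have e2 : 2 / (c * (Y : ℝ) ^ 2) = 1 * (2 * (1 / c) * (1 / (Y : ℝ) ^ 2)) := by
          field_simp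
        have hy : 0 < 1 / (Y : ℝ) ^ 2 := by positivity
        have e3 : ((Y ^ (4 * r + 4) : ℕ) : ℝ)⁻¹ ≤ (1 + Real.log X) * (1 * (1 / (Y : ℝ) ^ 2)) := by
          nlinarith
        have e4 : 1 * (2 * (1 / c) * (1 / (Y : ℝ) ^ 2))
            ≤ (1 + Real.log X) * (2 * (1 / c * (1 / c)) * (1 / (Y : ℝ) ^ 2)) := by
          gcongr
        have e5 : (1 + Real.log X) * (1 * (1 / (Y : ℝ) ^ 2))
            ≤ (1 + Real.log X) * ((1 / c * (1 / c)) * (1 / (Y : ℝ) ^ 2)) := by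
          gcongr
          linarith
        rw [e1, e2]
        linarith
      calc _ ≤ 2 * (1 + Real.log X) * ((1 + Real.log X) *
              (4 * (1 / c * (1 / c)) * (1 / (Y : ℝ) ^ 2))) := by gcongr
        _ ≤ 2 * (c₁ * E) * ((c₁ * E) * (4 * (1 / c * (1 / c)) * (1 / (Y : ℝ) ^ 2))) := by gcongr
        _ = 8 * ((c₁ * E) ^ 2 * (1 / (c * Y)) ^ 2) := by ring
        _ ≤ 9 * ((c₁ * E) ^ 2 * (1 / (c * Y)) ^ 2) := by gcongr; norm_num
        _ = _ := by ring
    have h5 : Real.log X ≤ c₁ * E := by linarith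
    calc _ ≤ (c₁ * E) * (D * E) * X * (c₁ * E * (3 / (c * Y))) := by gcongr
      _ = _ := by field_simp
  rw [hE3]
  calc _ ≤ 3 * c₁ / c * E ^ 3 * X / Y + 3 * c₁ ^ 2 * D / c * E ^ 3 * X / Y := add_le_add t1 t2
    _ = _ := by ring

/-! ### Primes in arithmetic progressions -/

/-- Orthogonality of the additive characters modulo `q`. -/
theorem sum_range_unitExp_mul_div {q : ℕ} (hq : 0 < q) (j : ℤ) :
    ∑ b ∈ Finset.range q, unitExp (b * (j / q)) = if (q : ℤ) ∣ j then (q : ℂ) else 0 := by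
  have hq' : (q : ℝ) ≠ 0 := by exact_mod_cast hq.ne'
  simp_rw [unitExp_nat_mul]
  split_ifs with h
  · obtain ⟨i, rfl⟩ := h
    have : unitExp (((q * i : ℤ) : ℝ) / q) = 1 := by
      rw [unitExp_eq_one_iff]
      exact ⟨i, by push_cast; field_simp⟩
    rw [Finset.sum_congr rfl fun x _ => by rw [this, one_pow]]
    simp
  · have h1 : unitExp ((j : ℝ) / q) ≠ 1 := by
      intro h1
      obtain ⟨i, hi⟩ := (unitExp_eq_one_iff _).1 h1
      rw [div_eq_iff hq'] at hi
      exact h ⟨i, by rw [mul_comm]; exact_mod_cast hi⟩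
    have h2 : unitExp ((j : ℝ) / q) ^ q = 1 := by
      rw [← unitExp_nat_mul, unitExp_eq_one_iff]
      exact ⟨j, by field_simp⟩
    have h3 := mul_geom_sum (unitExp ((j : ℝ) / q)) q
    rw [h2, sub_self] at h3
    exact (mul_eq_zero.1 h3).resolve_left (sub_ne_zero.2 h1)

/-- The residue class is detected with the additive characters modulo `q`, which shifts the
frequency `φ / q` by multiples of `1 / q`. -/
theorem norm_sum_vonMangoldt_progression_le {q a : ℕ} (haq : a < q) (M : ℕ) (φ : ℝ) {D : ℝ}
    (hD : ∀ b : ℕ, ‖∑ n ∈ Finset.Ioc 0 (q * M + a),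
      (ArithmeticFunction.vonMangoldt n : ℂ) * unitExp (n * ((φ + b) / q))‖ ≤ D) :
    ‖∑ m ∈ Finset.range (M + 1),
      (ArithmeticFunction.vonMangoldt (q * m + a) : ℂ) * unitExp (m * φ)‖ ≤ D := by
  have hq : 0 < q := by omega
  have hq' : (0 : ℝ) < q := by exact_mod_cast hq
  have hIoc : ∀ z : ℕ → ℂ, ∑ n ∈ Finset.Ioc 0 (q * M + a),
      (ArithmeticFunction.vonMangoldt n : ℂ) * z n = ∑ n ∈ Finset.range (q * M + a + 1),
      (ArithmeticFunction.vonMangoldt n : ℂ) * z n := by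
    intro z
    refine Finset.sum_subset (fun n hn => ?_) fun n hn hn' => ?_
    · rw [Finset.mem_Ioc] at hn; rw [Finset.mem_range]; omega
    · rw [Finset.mem_range] at hn
      rw [Finset.mem_Ioc] at hn'
      obtain rfl : n = 0 := by omega
      simp
  have key : ∑ b ∈ Finset.range q, unitExp (-(a * ((φ + b) / q))) *
      ∑ n ∈ Finset.Ioc 0 (q * M + a),
        (ArithmeticFunction.vonMangoldt n : ℂ) * unitExp (n * ((φ + b) / q))
      = q * ∑ m ∈ Finset.range (M + 1),
        (ArithmeticFunction.vonMangoldt (q * m + a) : ℂ) * unitExp (m * φ) := by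
    have h1 : ∀ b ∈ Finset.range q, unitExp (-(a * ((φ + b) / q))) *
        ∑ n ∈ Finset.Ioc 0 (q * M + a),
          (ArithmeticFunction.vonMangoldt n : ℂ) * unitExp (n * ((φ + b) / q))
        = ∑ n ∈ Finset.range (q * M + a + 1), (ArithmeticFunction.vonMangoldt n : ℂ) *
          unitExp (((n - a : ℤ) : ℝ) / q * φ) * unitExp (b * (((n - a : ℤ) : ℝ) / q)) := by
      intro b _
      rw [hIoc fun n => unitExp (n * ((φ + b) / q)), Finset.mul_sum]
      refine Finset.sum_congr rfl fun n _ => ?_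
      rw [mul_assoc, ← unitExp_add, mul_left_comm, ← unitExp_add]
      congr 2
      push_cast
      field_simp
      ring
    rw [Finset.sum_congr rfl h1, Finset.sum_comm]
    simp_rw [← Finset.mul_sum, sum_range_unitExp_mul_div hq, mul_ite, mul_zero]
    rw [← Finset.sum_filter, Finset.mul_sum]
    symm
    refine Finset.sum_bij (fun m _ => q * m + a) ?_ ?_ ?_ ?_
    · intro m hm
      rw [Finset.mem_range] at hm
      rw [Finset.mem_filter, Finset.mem_range]
      refine ⟨?_, ⟨m, by push_cast; ring⟩⟩
      have := Nat.mul_le_mul_left q (Nat.le_of_lt_succ hm)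
      omega
    · intro m _ m' _ h
      exact Nat.eq_of_mul_eq_mul_left hq (by omega)
    · intro n hn
      rw [Finset.mem_filter, Finset.mem_range] at hn
      obtain ⟨hn1, i, hi⟩ := hn
      have hq2 : (0 : ℤ) < q := by exact_mod_cast hq
      have hi0 : 0 ≤ i := by
        by_contra hneg
        push Not at hneg
        have : (q : ℤ) * i ≤ q * (-1) := by gcongr; omega
        omega
      lift i to ℕ using hi0
      have hn' : n = q * i + a := by zify; linarith
      refine ⟨i, ?_, hn'.symm⟩
      rw [Finset.mem_range]
      by_contra hneg
      push Not at hneg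
      have := Nat.mul_le_mul_left q hneg
      have h4 : q * (M + 1) = q * M + q := by ring
      omega
    · intro m _
      rw [mul_comm (q : ℂ)]
      congr 3
      push_cast
      field_simp
      ring
  have hnorm : ‖∑ b ∈ Finset.range q, unitExp (-(a * ((φ + b) / q))) *
      ∑ n ∈ Finset.Ioc 0 (q * M + a),
        (ArithmeticFunction.vonMangoldt n : ℂ) * unitExp (n * ((φ + b) / q))‖ ≤ q * D := by
    refine (norm_sum_le _ _).trans ((Finset.sum_le_card_nsmul _ _ D fun b _ => ?_).trans ?_)
    · rw [norm_mul, norm_unitExp, one_mul]; exact hD b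
    · simp
  rw [key, norm_mul, Complex.norm_natCast] at hnorm
  exact le_of_mul_le_mul_left hnorm hq'

/-! ### Diophantine approximation -/

theorem exists_pos_le_of_forall_lt {f : ℕ → ℝ} (n₀ : ℕ) (hf : ∀ n, 0 < n → 0 < f n) :
    ∃ c : ℝ, 0 < c ∧ ∀ n < n₀, 0 < n → c ≤ f n := by
  induction n₀ with
  | zero => exact ⟨1, one_pos, fun n hn => absurd hn (Nat.not_lt_zero n)⟩
  | succ k ih =>
    obtain ⟨c, hc, h⟩ := ih
    rcases Nat.eq_zero_or_pos k with rfl | hk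
    · exact ⟨1, one_pos, fun n hn hn0 => by omega⟩
    · refine ⟨min c (f k), lt_min hc (hf k hk), fun n hn hn0 => ?_⟩
      rcases Nat.lt_succ_iff_lt_or_eq.1 hn with h1 | rfl
      · exact (min_le_left _ _).trans (h n h1 hn0)
      · exact min_le_right _ _

/-- A natural exponent above the type lies outside the set whose supremum is the type, so the lower
limit at this exponent is positive; irrationality covers the finitely many small `n`. -/
theorem IsOfFiniteType.exists_le_pow_mul {α : ℝ} (hirr : Irrational α) (h : IsOfFiniteType α) :
    ∃ (r : ℕ) (c : ℝ), 0 < c ∧ ∀ n : ℕ, 0 < n → c ≤ (n : ℝ) ^ r * distNearestInt (α * n) := by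
  obtain ⟨ϱ, hϱ, -⟩ := EReal.lt_iff_exists_real_btwn.1 h
  obtain ⟨r, hr⟩ := exists_nat_ge ϱ
  set u : ℕ → ℝ := fun n => (n : ℝ) ^ (r : ℝ) * distNearestInt (α * n) with hu
  have hu0 : ∀ n, 0 ≤ u n := fun n =>
    mul_nonneg (Real.rpow_nonneg (Nat.cast_nonneg n) _) (distNearestInt_nonneg _)
  have hpos : ∀ n, 0 < n → 0 < u n := by
    intro n hn
    have hn' : (0 : ℝ) < n := by exact_mod_cast hn
    refine mul_pos (Real.rpow_pos_of_pos hn' _) (abs_pos.2 (sub_ne_zero.2 ?_))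
    exact (hirr.mul_natCast hn.ne').ne_int _
  have hne : Filter.liminf (fun n => ((u n : ℝ) : EReal)) Filter.atTop ≠ 0 := by
    intro h0
    have h1 : ((r : ℝ) : EReal) ≤ diophantineType α := le_sSup ⟨(r : ℝ), h0, rfl⟩
    have h2 : ((r : ℝ) : EReal) < (ϱ : EReal) := h1.trans_lt hϱ
    exact absurd (EReal.coe_lt_coe_iff.1 h2) (not_lt.2 hr)
  have hge : 0 ≤ Filter.liminf (fun n => ((u n : ℝ) : EReal)) Filter.atTop :=
    Filter.le_liminf_of_le (h := Filter.Eventually.of_forall fun n => by exact_mod_cast hu0 n)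
  obtain ⟨b, hb0, hb⟩ := EReal.lt_iff_exists_real_btwn.1 (lt_of_le_of_ne hge hne.symm)
  obtain ⟨n₀, hn₀⟩ := Filter.eventually_atTop.1 (Filter.eventually_lt_of_lt_liminf hb)
  obtain ⟨c, hc, hc'⟩ := exists_pos_le_of_forall_lt n₀ hpos
  refine ⟨r, min b c, lt_min (by exact_mod_cast hb0) hc, fun n hn => ?_⟩
  have : u n = (n : ℝ) ^ r * distNearestInt (α * n) := by rw [hu]; simp
  rw [← this]
  rcases lt_or_ge n n₀ with h1 | h1
  · exact (min_le_right _ _).trans (hc' n h1 hn)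
  · exact (min_le_left _ _).trans (by exact_mod_cast (hn₀ n h1).le)

/-- A lower bound for the distances of the multiples of `α` to the integers passes to `α⁻¹`:
`|h / α - m|` equals `|α m - h| / α`, and only `m` comparable with `h` matters. -/
theorem exists_le_pow_mul_distNearestInt_inv {α : ℝ} (hα : 0 < α) {r : ℕ} {c : ℝ} (hc : 0 < c)
    (h : ∀ n : ℕ, 0 < n → c ≤ (n : ℝ) ^ r * distNearestInt (α * n)) :
    ∃ c' : ℝ, 0 < c' ∧ c' ≤ 1 ∧
      ∀ n : ℕ, 0 < n → c' ≤ (n : ℝ) ^ r * distNearestInt (n * α⁻¹) := by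
  have hα' : 0 < α⁻¹ := inv_pos.2 hα
  refine ⟨min (min (1 / 2) α⁻¹) (c * α⁻¹ / (α⁻¹ + 1) ^ r), by positivity, ?_, fun n hn => ?_⟩
  · exact (min_le_left _ _).trans ((min_le_left _ _).trans (by norm_num))
  have hn1 : (1 : ℝ) ≤ n := by exact_mod_cast hn
  have hnr : (1 : ℝ) ≤ (n : ℝ) ^ r := one_le_pow₀ hn1
  set m : ℤ := round ((n : ℝ) * α⁻¹) with hm
  have hd : distNearestInt (n * α⁻¹) = |n * α⁻¹ - m| := rfl
  have hhalf : |n * α⁻¹ - m| ≤ 1 / 2 := abs_sub_round _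
  rw [hd]
  have hx : α⁻¹ ≤ n * α⁻¹ := le_mul_of_one_le_left hα'.le hn1
  rcases le_or_gt m 0 with hm0 | hm0
  · have hm0' : (m : ℝ) ≤ 0 := by exact_mod_cast hm0
    have h1 : α⁻¹ ≤ |n * α⁻¹ - m| := by
      refine le_trans ?_ (le_abs_self _)
      linarith
    refine (min_le_left _ _).trans ((min_le_right _ _).trans (h1.trans ?_))
    exact le_mul_of_one_le_left (abs_nonneg _) hnr
  · obtain ⟨k, hk⟩ : ∃ k : ℕ, m = k := ⟨m.toNat, by omega⟩
    rw [hk] at hhalf hm0 ⊢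
    have hk0 : 0 < k := by exact_mod_cast hm0
    push_cast at hhalf ⊢
    have h1 : |α * k - n| = α * |n * α⁻¹ - k| := by
      rw [show α * k - n = -(α * (n * α⁻¹ - k)) by field_simp; ring, abs_neg, abs_mul,
        abs_of_pos hα]
    have h2 : (k : ℝ) ≤ (α⁻¹ + 1) * n := by
      have := (abs_le.1 hhalf).1
      nlinarith
    have h3 := h k hk0
    have h4 : distNearestInt (α * k) ≤ |α * k - n| := by
      simpa using distNearestInt_le (α * k) n
    have h5 : c ≤ ((α⁻¹ + 1) * n) ^ r * (α * |n * α⁻¹ - k|) := by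
      rw [← h1]
      refine h3.trans ?_
      have := distNearestInt_nonneg (α * k)
      gcongr
    refine (min_le_right _ _).trans ?_
    rw [div_le_iff₀ (by positivity), ← div_eq_mul_inv, div_le_iff₀ hα]
    rw [mul_pow] at h5
    linarith

/-- The rational shifts that come from the additive characters preserve the Diophantine
condition up to a factor `q * k ^ r`. -/
theorem le_mul_distNearestInt_div {γ c : ℝ} {r : ℕ}
    (h : ∀ n : ℕ, 0 < n → c ≤ (n : ℝ) ^ r * distNearestInt (n * γ)) {q k : ℕ} (hq : 0 < q)
    (hk : 0 < k) (b n : ℕ) (hn : 0 < n) :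
    c ≤ (q * (k : ℝ) ^ r) * (n : ℝ) ^ r * distNearestInt (n * ((k * γ + b) / q)) := by
  have hq' : (0 : ℝ) < q := by exact_mod_cast hq
  set l : ℤ := round ((n : ℝ) * ((k * γ + b) / q)) with hl
  have hd : distNearestInt (n * ((k * γ + b) / q)) = |n * ((k * γ + b) / q) - l| := rfl
  have h1 := h (n * k) (Nat.mul_pos hn hk)
  have h2 := distNearestInt_le ((n * k : ℕ) * γ) (l * q - n * b)
  have h3 : |((n * k : ℕ) : ℝ) * γ - ((l * q - n * b : ℤ) : ℝ)|
      = q * |n * ((k * γ + b) / q) - l| := by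
    rw [← abs_of_pos hq', ← abs_mul, abs_of_pos hq']
    congr 1
    push_cast
    field_simp
    ring
  rw [h3] at h2
  rw [hd]
  calc c ≤ ((n * k : ℕ) : ℝ) ^ r * distNearestInt ((n * k : ℕ) * γ) := h1
    _ ≤ ((n * k : ℕ) : ℝ) ^ r * (q * |n * ((k * γ + b) / q) - l|) := by gcongr
    _ = _ := by push_cast; rw [mul_pow]; ring

/-- The exponential sum along a residue class, with the modulus `q` and the multiple `k` of the
frequency both at most `Y ^ 2`. -/
theorem exists_norm_sum_progression_le {γ c η : ℝ} {r : ℕ} (hc : 0 < c) (hc1 : c ≤ 1) (hη : 0 < η)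
    (h : ∀ n : ℕ, 0 < n → c ≤ (n : ℝ) ^ r * distNearestInt (n * γ)) :
    ∃ C : ℝ, 0 < C ∧ ∀ q a k M Y : ℕ, a < q → q ≤ Y ^ 2 → 0 < k → k ≤ Y ^ 2 →
      Y ^ (4 * (4 * r ^ 2 + 9 * r + 5)) ≤ q * M + a →
      ‖∑ m ∈ Finset.range (M + 1),
        (ArithmeticFunction.vonMangoldt (q * m + a) : ℂ) * unitExp (m * (k * γ))‖
        ≤ C * ((q * M + a : ℕ) : ℝ) ^ η * ((q * M + a : ℕ) : ℝ) / Y := by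
  obtain ⟨C, hC, hmain⟩ := exists_norm_sum_vonMangoldt_le r hc hc1 hη
  refine ⟨C, hC, fun q a k M Y haq hqY hk hkY hYX => ?_⟩
  have hY : 0 < Y := Nat.pos_of_ne_zero fun h0 => by simp [h0] at hkY; omega
  refine norm_sum_vonMangoldt_progression_le haq M _ fun b => ?_
  refine hmain _ Y _ hY hYX fun n hn => ?_
  refine (le_mul_distNearestInt_div (q := q) h (by omega) hk b n hn).trans ?_
  have h0 := distNearestInt_nonneg (n * ((k * γ + b) / q))
  have h1 : (q : ℝ) ≤ (Y : ℝ) ^ 2 := by exact_mod_cast hqY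
  have h2 : (k : ℝ) ≤ (Y : ℝ) ^ 2 := by exact_mod_cast hkY
  have h3 : q * (k : ℝ) ^ r ≤ (Y : ℝ) ^ (2 * r + 2) := by
    calc q * (k : ℝ) ^ r ≤ (Y : ℝ) ^ 2 * ((Y : ℝ) ^ 2) ^ r := by gcongr
      _ = _ := by rw [← pow_mul, ← pow_add]; congr 1; ring
  exact mul_le_mul_of_nonneg_right (mul_le_mul_of_nonneg_right h3 (by positivity)) h0

/-! ### The sawtooth function -/

/-- The sawtooth function `{x} - 1 / 2`. -/
noncomputable def sawtooth (x : ℝ) : ℝ := Int.fract x - 1 / 2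

/-- The periodic second Bernoulli function, which is twice an antiderivative of the sawtooth
function. -/
noncomputable def periodicBernoulliTwo (x : ℝ) : ℝ := Int.fract x ^ 2 - Int.fract x + 6⁻¹

theorem hasSum_cos_div_sq (x : ℝ) :
    HasSum (fun n : ℕ => 1 / (n : ℝ) ^ 2 * Real.cos (2 * Real.pi * (n * x)))
      (Real.pi ^ 2 * periodicBernoulliTwo x) := by
  have h := hasSum_one_div_nat_pow_mul_cos one_ne_zero
    (x := Int.fract x) ⟨Int.fract_nonneg x, (Int.fract_lt_one x).le⟩
  have h2 : (Polynomial.map (algebraMap ℚ ℝ) (Polynomial.bernoulli (2 * 1))).eval (Int.fract x)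
      = periodicBernoulliTwo x := bernoulliFun_two _
  rw [h2] at h
  have h3 : ∀ n : ℕ, Real.cos (2 * Real.pi * n * Int.fract x)
      = Real.cos (2 * Real.pi * (n * x)) := by
    intro n
    rw [show 2 * Real.pi * n * Int.fract x
      = 2 * Real.pi * (n * x) - ((n * ⌊x⌋ : ℤ) : ℝ) * (2 * Real.pi) by
        rw [Int.fract]; push_cast; ring, Real.cos_sub_int_mul_two_pi]
  have h4 : (-1 : ℝ) ^ (1 + 1) * (2 * Real.pi) ^ (2 * 1) / 2 / ((2 * 1).factorial : ℝ)
      = Real.pi ^ 2 := by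
    norm_num [Nat.factorial]
    ring
  simp only [h3, h4, mul_one] at h
  exact h

/-- Sums of a nonnegative weight against the second Bernoulli function are controlled by finitely
many exponential sums, since its Fourier coefficients decay quadratically. -/
theorem abs_sum_mul_periodicBernoulliTwo_le {f : ℕ → ℝ} (hf : ∀ m, 0 ≤ f m) (s : Finset ℕ)
    {γ S : ℝ} {K : ℕ} (hK : 0 < K)
    (hS : ∀ k : ℕ, 0 < k → k ≤ K → ‖∑ m ∈ s, (f m : ℂ) * unitExp (m * (k * γ))‖ ≤ S) (δ : ℝ) :
    |∑ m ∈ s, f m * periodicBernoulliTwo (m * γ + δ)| ≤ S + (∑ m ∈ s, f m) / K := by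
  set F := ∑ m ∈ s, f m with hF
  have hF0 : 0 ≤ F := Finset.sum_nonneg fun m _ => hf m
  have hS0 : 0 ≤ S := (norm_nonneg _).trans (hS 1 one_pos hK)
  set T : ℕ → ℝ := fun k => ∑ m ∈ s, f m * Real.cos (2 * Real.pi * (k * (m * γ + δ))) with hT
  have hTre : ∀ k : ℕ, |T k| ≤ ‖∑ m ∈ s, (f m : ℂ) * unitExp (m * (k * γ))‖ := by
    intro k
    have h1 : T k = (unitExp (k * δ) * ∑ m ∈ s, (f m : ℂ) * unitExp (m * (k * γ))).re := by
      rw [Finset.mul_sum, Complex.re_sum]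
      refine Finset.sum_congr rfl fun m _ => ?_
      rw [mul_left_comm (unitExp (k * δ)), ← unitExp_add, Complex.re_ofReal_mul, re_unitExp]
      congr 3
      ring
    rw [h1]
    refine (Complex.abs_re_le_norm _).trans ?_
    rw [norm_mul, norm_unitExp, one_mul]
  have hTF : ∀ k, |T k| ≤ F := by
    intro k
    refine (Finset.abs_sum_le_sum_abs _ _).trans (Finset.sum_le_sum fun m _ => ?_)
    rw [abs_mul, abs_of_nonneg (hf m)]
    exact mul_le_of_le_one_right (hf m) (Real.abs_cos_le_one _)
  have hsum : HasSum (fun k : ℕ => 1 / (k : ℝ) ^ 2 * T k)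
      (Real.pi ^ 2 * ∑ m ∈ s, f m * periodicBernoulliTwo (m * γ + δ)) := by
    have := hasSum_sum (s := s) fun m _ => (hasSum_cos_div_sq (m * γ + δ)).mul_left (f m)
    have e1 : ∀ k : ℕ, 1 / (k : ℝ) ^ 2 * T k = ∑ m ∈ s,
        f m * (1 / (k : ℝ) ^ 2 * Real.cos (2 * Real.pi * (k * (m * γ + δ)))) := by
      intro k
      simp only [hT]
      rw [Finset.mul_sum]
      exact Finset.sum_congr rfl fun m _ => by ring
    have e2 : Real.pi ^ 2 * ∑ m ∈ s, f m * periodicBernoulliTwo (m * γ + δ)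
        = ∑ m ∈ s, f m * (Real.pi ^ 2 * periodicBernoulliTwo (m * γ + δ)) := by
      rw [Finset.mul_sum]
      exact Finset.sum_congr rfl fun m _ => by ring
    simp only [e1, e2]
    exact this
  have hpart : ∀ n : ℕ, |∑ k ∈ Finset.range n, 1 / (k : ℝ) ^ 2 * T k| ≤ 2 * S + F / K := by
    intro n
    have h1 : ∀ k ∈ Finset.range n, |1 / (k : ℝ) ^ 2 * T k|
        ≤ S * (1 / (k : ℝ) ^ 2) + (if K < k then F * ((k : ℝ) ^ 2)⁻¹ else 0) := by
      intro k _
      rw [abs_mul, abs_of_nonneg (by positivity : 0 ≤ 1 / (k : ℝ) ^ 2)]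
      split_ifs with hk
      · have h2 := mul_le_mul_of_nonneg_left (hTF k) (by positivity : 0 ≤ 1 / (k : ℝ) ^ 2)
        have h3 : 0 ≤ S * (1 / (k : ℝ) ^ 2) := by positivity
        rw [one_div] at h2 h3 ⊢
        linarith
      · rcases Nat.eq_zero_or_pos k with rfl | hk0
        · simp
        · have h2 := mul_le_mul_of_nonneg_left ((hTre k).trans (hS k hk0 (not_lt.1 hk)))
            (by positivity : 0 ≤ 1 / (k : ℝ) ^ 2)
          linarith
    refine (Finset.abs_sum_le_sum_abs _ _).trans ((Finset.sum_le_sum h1).trans ?_)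
    rw [Finset.sum_add_distrib, ← Finset.mul_sum, ← Finset.sum_filter, ← Finset.mul_sum]
    have h2 : ∑ k ∈ Finset.range n, 1 / (k : ℝ) ^ 2 ≤ 2 := by
      refine (sum_le_hasSum _ (fun k _ => by positivity) hasSum_zeta_two).trans ?_
      nlinarith [Real.pi_lt_d2, Real.pi_pos]
    have h3 : ∑ k ∈ (Finset.range n).filter (K < ·), ((k : ℝ) ^ 2)⁻¹ ≤ (K : ℝ)⁻¹ := by
      refine le_trans (Finset.sum_le_sum_of_subset_of_nonneg (t := Finset.Ioc K n) ?_
        fun _ _ _ => by positivity) (sum_Ioc_inv_sq_le K n hK)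
      intro k hk
      rw [Finset.mem_filter, Finset.mem_range] at hk
      rw [Finset.mem_Ioc]
      omega
    have h4 := mul_le_mul_of_nonneg_left h2 hS0
    have h5 := mul_le_mul_of_nonneg_left h3 hF0
    rw [div_eq_mul_inv]
    linarith
  have hlim := le_of_tendsto hsum.tendsto_sum_nat.abs (Filter.Eventually.of_forall hpart)
  rw [abs_mul, abs_of_nonneg (sq_nonneg Real.pi)] at hlim
  have hFK : 0 ≤ F / K := by positivity
  have hpi : 2 ≤ Real.pi ^ 2 := by nlinarith [Real.pi_gt_three]
  have := abs_nonneg (∑ m ∈ s, f m * periodicBernoulliTwo (m * γ + δ))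
  nlinarith

theorem periodicBernoulliTwo_add_sub_le (x : ℝ) {Δ : ℝ} (h0 : 0 ≤ Δ) (h1 : Δ ≤ 1) :
    periodicBernoulliTwo (x + Δ) - periodicBernoulliTwo x ≤ 2 * Δ * sawtooth x + Δ ^ 2 := by
  have hp0 := Int.fract_nonneg x
  have hp1 := Int.fract_lt_one x
  have hx := Int.floor_add_fract x
  unfold periodicBernoulliTwo sawtooth
  rcases lt_or_ge (Int.fract x + Δ) 1 with h | h
  · have : Int.fract (x + Δ) = Int.fract x + Δ :=
      Int.fract_eq_iff.2 ⟨by linarith, h, ⌊x⌋, by linarith⟩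
    rw [this]
    nlinarith
  · have : Int.fract (x + Δ) = Int.fract x + Δ - 1 :=
      Int.fract_eq_iff.2 ⟨by linarith, by linarith, ⌊x⌋ + 1, by push_cast; linarith⟩
    rw [this]
    nlinarith

theorem le_periodicBernoulliTwo_sub_sub (x : ℝ) {Δ : ℝ} (h0 : 0 ≤ Δ) (h1 : Δ ≤ 1) :
    2 * Δ * sawtooth x - Δ ^ 2 ≤ periodicBernoulliTwo x - periodicBernoulliTwo (x - Δ) := by
  have hp0 := Int.fract_nonneg x
  have hp1 := Int.fract_lt_one x
  have hx := Int.floor_add_fract x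
  unfold periodicBernoulliTwo sawtooth
  rcases le_or_gt 0 (Int.fract x - Δ) with h | h
  · have : Int.fract (x - Δ) = Int.fract x - Δ :=
      Int.fract_eq_iff.2 ⟨h, by linarith, ⌊x⌋, by linarith⟩
    rw [this]
    nlinarith
  · have : Int.fract (x - Δ) = Int.fract x - Δ + 1 :=
      Int.fract_eq_iff.2 ⟨by linarith, by linarith, ⌊x⌋ - 1, by push_cast; linarith⟩
    rw [this]
    nlinarith

/-- Averaging over a window of length `Δ` sandwiches the sawtooth function between difference
quotients of the second Bernoulli function. -/
theorem abs_sum_mul_sawtooth_le {f : ℕ → ℝ} (hf : ∀ m, 0 ≤ f m) (s : Finset ℕ)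
    {γ S Δ : ℝ} {K : ℕ} (hK : 0 < K) (h0 : 0 < Δ) (h1 : Δ ≤ 1)
    (hS : ∀ k : ℕ, 0 < k → k ≤ K → ‖∑ m ∈ s, (f m : ℂ) * unitExp (m * (k * γ))‖ ≤ S) (δ : ℝ) :
    |∑ m ∈ s, f m * sawtooth (m * γ + δ)|
      ≤ Δ * (∑ m ∈ s, f m) + (S + (∑ m ∈ s, f m) / K) / Δ := by
  set F := ∑ m ∈ s, f m with hF
  have hF0 : 0 ≤ F := Finset.sum_nonneg fun m _ => hf m
  set P : ℝ → ℝ := fun t => ∑ m ∈ s, f m * periodicBernoulliTwo (m * γ + t) with hP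
  have hPle : ∀ t, |P t| ≤ S + F / K := abs_sum_mul_periodicBernoulliTwo_le hf s hK hS
  set A := ∑ m ∈ s, f m * sawtooth (m * γ + δ) with hA
  have hlow : P (δ + Δ) - P δ ≤ 2 * Δ * A + Δ ^ 2 * F := by
    rw [hP, hA, hF, Finset.mul_sum, Finset.mul_sum, ← Finset.sum_sub_distrib,
      ← Finset.sum_add_distrib]
    refine Finset.sum_le_sum fun m _ => ?_
    have := mul_le_mul_of_nonneg_left
      (periodicBernoulliTwo_add_sub_le (m * γ + δ) h0.le h1) (hf m)
    rw [← add_assoc]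
    linarith
  have hupp : 2 * Δ * A - Δ ^ 2 * F ≤ P δ - P (δ - Δ) := by
    rw [hP, hA, hF, Finset.mul_sum, Finset.mul_sum, ← Finset.sum_sub_distrib,
      ← Finset.sum_sub_distrib]
    refine Finset.sum_le_sum fun m _ => ?_
    have := mul_le_mul_of_nonneg_left
      (le_periodicBernoulliTwo_sub_sub (m * γ + δ) h0.le h1) (hf m)
    rw [← add_sub_assoc]
    linarith
  have e1 := abs_le.1 (hPle δ)
  have e2 := abs_le.1 (hPle (δ + Δ))
  have e3 := abs_le.1 (hPle (δ - Δ))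
  have hF2 : 0 ≤ Δ ^ 2 * F := by positivity
  have hmain : |A| * Δ ≤ (Δ * F) * Δ + (S + F / K) := by
    rw [← abs_of_pos h0, ← abs_mul, abs_of_pos h0, abs_le]
    constructor <;> nlinarith
  rw [← sub_le_iff_le_add', le_div_iff₀ h0]
  linarith

/-! ### Counting the terms of a Beatty sequence -/

theorem floor_eq_iff_mem_Ico {α β : ℝ} (hα : 0 < α) (m n : ℤ) :
    ⌊α * n + β⌋ = m ↔ n ∈ Finset.Ico ⌈((m : ℝ) - β) * α⁻¹⌉ ⌈(((m + 1 : ℤ) : ℝ) - β) * α⁻¹⌉ := by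
  rw [Finset.mem_Ico, Int.ceil_le, Int.lt_ceil, Int.floor_eq_iff, ← div_eq_mul_inv,
    ← div_eq_mul_inv, div_le_iff₀ hα, lt_div_iff₀ hα]
  push_cast
  constructor <;> rintro ⟨h1, h2⟩ <;> constructor <;> linarith

/-- The number of integers `n` with `⌊α n + β⌋ = m` is `α⁻¹` plus a difference of sawtooth
values. -/
theorem card_Ico_ceil_eq {α β : ℝ} (hα : 0 < α) (m : ℤ) :
    ((Finset.Ico ⌈((m : ℝ) - β) * α⁻¹⌉ ⌈(((m + 1 : ℤ) : ℝ) - β) * α⁻¹⌉).card : ℝ)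
      = α⁻¹ + sawtooth (m * -α⁻¹ + (β * α⁻¹ - α⁻¹)) - sawtooth (m * -α⁻¹ + β * α⁻¹) := by
  have hle : ⌈((m : ℝ) - β) * α⁻¹⌉ ≤ ⌈(((m + 1 : ℤ) : ℝ) - β) * α⁻¹⌉ := by
    apply Int.ceil_le_ceil
    have := inv_pos.2 hα
    push_cast
    nlinarith
  have h1 : ((Finset.Ico ⌈((m : ℝ) - β) * α⁻¹⌉ ⌈(((m + 1 : ℤ) : ℝ) - β) * α⁻¹⌉).card : ℝ)
      = (⌈(((m + 1 : ℤ) : ℝ) - β) * α⁻¹⌉ : ℝ) - ⌈((m : ℝ) - β) * α⁻¹⌉ := by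
    rw [Int.card_Ico, ← Int.cast_natCast, Int.toNat_of_nonneg (by omega)]
    push_cast
    ring
  have h2 : ∀ y : ℝ, (⌈y⌉ : ℝ) = y + sawtooth (-y) + 1 / 2 := by
    intro y
    rw [sawtooth, Int.fract, Int.floor_neg]
    push_cast
    ring
  rw [h1, h2, h2, show -((((m + 1 : ℤ) : ℝ) - β) * α⁻¹) = m * -α⁻¹ + (β * α⁻¹ - α⁻¹) by
    push_cast; ring, show -(((m : ℝ) - β) * α⁻¹) = m * -α⁻¹ + β * α⁻¹ by ring]
  push_cast
  ring

theorem abs_sawtooth_le (x : ℝ) : |sawtooth x| ≤ 1 / 2 := by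
  have h0 := Int.fract_nonneg x
  have h1 := Int.fract_lt_one x
  rw [sawtooth, abs_le]
  constructor <;> linarith

/-- The number of `n ∈ [1, N]` with `⌊α n + β⌋ = m` is at most the number of all such integers
`n`, with equality unless `m` is at the lower end of the range or is its last element. -/
theorem card_filter_floor_eq {α β : ℝ} (hα : 0 < α) (N : ℕ) (m : ℤ) :
    ((Finset.Icc 1 N).filter fun n : ℕ => ⌊α * n + β⌋ = m).card
        ≤ (Finset.Ico ⌈((m : ℝ) - β) * α⁻¹⌉ ⌈(((m + 1 : ℤ) : ℝ) - β) * α⁻¹⌉).card ∧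
      (⌊α + β⌋ < m → m < ⌊α * N + β⌋ →
        ((Finset.Icc 1 N).filter fun n : ℕ => ⌊α * n + β⌋ = m).card
        = (Finset.Ico ⌈((m : ℝ) - β) * α⁻¹⌉ ⌈(((m + 1 : ℤ) : ℝ) - β) * α⁻¹⌉).card) := by
  set I := Finset.Ico ⌈((m : ℝ) - β) * α⁻¹⌉ ⌈(((m + 1 : ℤ) : ℝ) - β) * α⁻¹⌉ with hI
  have hmem : ∀ n : ℤ, ⌊α * n + β⌋ = m ↔ n ∈ I := floor_eq_iff_mem_Ico hα m
  have hinj : Set.InjOn (fun n : ℕ => (n : ℤ))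
      (((Finset.Icc 1 N).filter fun n : ℕ => ⌊α * n + β⌋ = m : Finset ℕ) : Set ℕ) :=
    (Nat.cast_injective (R := ℤ)).injOn
  have hmaps : ∀ n ∈ (Finset.Icc 1 N).filter fun n : ℕ => ⌊α * n + β⌋ = m, (n : ℤ) ∈ I := by
    intro n hn
    rw [← hmem]
    exact_mod_cast (Finset.mem_filter.1 hn).2
  refine ⟨Finset.card_le_card_of_injOn _ hmaps hinj, fun h1 h2 => ?_⟩
  refine Finset.card_bij (fun n _ => (n : ℤ)) hmaps (fun a _ b _ h => by exact_mod_cast h) ?_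
  intro n hn
  rw [← hmem] at hn
  have hn1 : 1 ≤ n := by
    by_contra h
    push Not at h
    have h3 : (n : ℝ) ≤ 0 := by exact_mod_cast (by omega : n ≤ 0)
    have h4 : ⌊α * n + β⌋ ≤ ⌊α + β⌋ := Int.floor_le_floor (by nlinarith)
    omega
  have hnN : n ≤ N := by
    by_contra h
    push Not at h
    have h3 : (N : ℝ) ≤ n := by exact_mod_cast h.le
    have h4 : ⌊α * N + β⌋ ≤ ⌊α * n + β⌋ := Int.floor_le_floor (by gcongr)
    omega
  lift n to ℕ using by omega
  refine ⟨n, Finset.mem_filter.2 ⟨Finset.mem_Icc.2 ⟨by omega, by omega⟩, ?_⟩, rfl⟩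
  exact_mod_cast hn

/-- A sum over a Beatty sequence compared with the sum over all integers. -/
theorem abs_sum_beatty_sub_le {α β : ℝ} (hα : 0 < α) {g : ℤ → ℝ} {G : ℝ} {N M : ℕ}
    (hM : ⌊α * N + β⌋ = M) (hg : ∀ m, 0 ≤ g m) (hneg : ∀ m < 0, g m = 0)
    (hG : ∀ m : ℕ, m ≤ M → g m ≤ G) :
    |∑ n ∈ Finset.Icc 1 N, g ⌊α * (n : ℝ) + β⌋ - α⁻¹ * ∑ m ∈ Finset.Icc (1 : ℤ) M, g m|
      ≤ |∑ m ∈ Finset.range (M + 1), g m * sawtooth (m * -α⁻¹ + (β * α⁻¹ - α⁻¹))|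
        + |∑ m ∈ Finset.range (M + 1), g m * sawtooth (m * -α⁻¹ + β * α⁻¹)|
        + ((α⁻¹ + 1) * (|α + β| + 2) + α⁻¹) * G := by
  have hα' : 0 < α⁻¹ := inv_pos.2 hα
  have hG0 : 0 ≤ G := (hg _).trans (hG 0 (Nat.zero_le _))
  set r : ℤ → ℕ := fun m => ((Finset.Icc 1 N).filter fun n : ℕ => ⌊α * n + β⌋ = m).card with hr
  set c : ℤ → ℕ := fun m =>
    (Finset.Ico ⌈((m : ℝ) - β) * α⁻¹⌉ ⌈(((m + 1 : ℤ) : ℝ) - β) * α⁻¹⌉).card with hc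
  have hfib : ∑ n ∈ Finset.Icc 1 N, g ⌊α * (n : ℝ) + β⌋
      = ∑ m ∈ Finset.range (M + 1), g m * r m := by
    have h1 : ∀ n ∈ Finset.Icc 1 N, g ⌊α * (n : ℝ) + β⌋
        = ∑ m ∈ Finset.range (M + 1), if ⌊α * (n : ℝ) + β⌋ = m then g m else 0 := by
      intro n hn
      have hle : ⌊α * (n : ℝ) + β⌋ ≤ M := by
        rw [← hM]
        have : (n : ℝ) ≤ N := by exact_mod_cast (Finset.mem_Icc.1 hn).2
        exact Int.floor_le_floor (by gcongr)
      rcases lt_or_ge ⌊α * (n : ℝ) + β⌋ 0 with h | h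
      · rw [hneg _ h]
        refine (Finset.sum_eq_zero fun m _ => if_neg ?_).symm
        omega
      · obtain ⟨k, hk⟩ := Int.eq_ofNat_of_zero_le h
        rw [hk] at hle ⊢
        rw [Finset.sum_eq_single_of_mem k (by rw [Finset.mem_range]; omega)]
        · simp
        · intro b _ hb
          rw [if_neg]
          exact fun h => hb (by exact_mod_cast h.symm)
    rw [Finset.sum_congr rfl h1, Finset.sum_comm]
    refine Finset.sum_congr rfl fun m _ => ?_
    rw [← Finset.sum_filter, Finset.sum_const, nsmul_eq_mul, mul_comm]
  have hcard : ∑ m ∈ Finset.range (M + 1), g m * c m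
      = α⁻¹ * ∑ m ∈ Finset.range (M + 1), g m
        + ∑ m ∈ Finset.range (M + 1), g m * sawtooth (m * -α⁻¹ + (β * α⁻¹ - α⁻¹))
        - ∑ m ∈ Finset.range (M + 1), g m * sawtooth (m * -α⁻¹ + β * α⁻¹) := by
    rw [Finset.mul_sum, ← Finset.sum_add_distrib, ← Finset.sum_sub_distrib]
    refine Finset.sum_congr rfl fun m _ => ?_
    have := card_Ico_ceil_eq (β := β) hα m
    rw [Int.cast_natCast] at this
    simp only [hc]
    rw [Int.cast_natCast, this]
    ring
  have hcle : ∀ m : ℤ, (c m : ℝ) ≤ α⁻¹ + 1 := by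
    intro m
    have h1 := card_Ico_ceil_eq (β := β) hα m
    have h2 := abs_le.1 (abs_sawtooth_le (m * -α⁻¹ + (β * α⁻¹ - α⁻¹)))
    have h3 := abs_le.1 (abs_sawtooth_le (m * -α⁻¹ + β * α⁻¹))
    simp only [hc]
    linarith
  have hdiff : |∑ m ∈ Finset.range (M + 1), g m * r m - ∑ m ∈ Finset.range (M + 1), g m * c m|
      ≤ (α⁻¹ + 1) * (|α + β| + 2) * G := by
    set bad := (Finset.range (M + 1)).filter fun m : ℕ => (m : ℤ) ≤ ⌊α + β⌋ ∨ m = M with hbad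
    rw [← Finset.sum_sub_distrib]
    have h1 : ∀ m ∈ Finset.range (M + 1), |g m * r m - g m * c m|
        ≤ if (m : ℤ) ≤ ⌊α + β⌋ ∨ m = M then G * (α⁻¹ + 1) else 0 := by
      intro m hm
      have hmM : m ≤ M := Nat.le_of_lt_succ (Finset.mem_range.1 hm)
      obtain ⟨hle, heq⟩ := card_filter_floor_eq (β := β) hα N m
      split_ifs with h
      · have h3 : (r m : ℝ) ≤ c m := by exact_mod_cast hle
        have h4 : (0 : ℝ) ≤ r m := Nat.cast_nonneg _
        rw [← mul_sub, abs_mul, abs_of_nonneg (hg m), abs_sub_comm, abs_of_nonneg (by linarith)]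
        have h5 := hcle m
        exact mul_le_mul (hG m hmM) (by linarith) (by linarith) hG0
      · push Not at h
        have h3 : r m = c m := heq h.1 (by rw [hM]; have := h.2; omega)
        rw [h3, sub_self, abs_zero]
    refine (Finset.abs_sum_le_sum_abs _ _).trans ((Finset.sum_le_sum h1).trans ?_)
    rw [← Finset.sum_filter, Finset.sum_const, nsmul_eq_mul]
    have h6 : (bad.card : ℝ) ≤ |α + β| + 2 := by
      have h7 : bad ⊆ insert M (Finset.range (⌊α + β⌋.toNat + 1)) := by
        intro m hm
        rw [Finset.mem_insert, Finset.mem_range]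
        rcases (Finset.mem_filter.1 hm).2 with h | h
        · right; omega
        · exact Or.inl h
      have h8 : bad.card ≤ ⌊α + β⌋.toNat + 1 + 1 :=
        (Finset.card_le_card h7).trans ((Finset.card_insert_le _ _).trans (by simp))
      have h9 : ((⌊α + β⌋.toNat : ℕ) : ℝ) ≤ |α + β| := by
        rcases le_or_gt 0 ⌊α + β⌋ with h | h
        · have : ((⌊α + β⌋.toNat : ℕ) : ℝ) = (⌊α + β⌋ : ℝ) := by
            exact_mod_cast congrArg (Int.cast (R := ℝ)) (Int.toNat_of_nonneg h)
          rw [this]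
          exact (Int.floor_le _).trans (le_abs_self _)
        · rw [Int.toNat_of_nonpos h.le]
          simp
      have h10 : (bad.card : ℝ) ≤ ((⌊α + β⌋.toNat + 1 + 1 : ℕ) : ℝ) := by exact_mod_cast h8
      push_cast at h10
      linarith
    calc (bad.card : ℝ) * (G * (α⁻¹ + 1)) ≤ (|α + β| + 2) * (G * (α⁻¹ + 1)) := by gcongr
      _ = _ := by ring
  have hzero : ∑ m ∈ Finset.range (M + 1), g m = g 0 + ∑ m ∈ Finset.Icc (1 : ℤ) M, g m := by
    rw [Finset.sum_range_succ', add_comm]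
    congr 1
    refine Finset.sum_bij (fun m _ => ((m + 1 : ℕ) : ℤ)) ?_ ?_ ?_ ?_
    · intro m hm
      rw [Finset.mem_range] at hm
      rw [Finset.mem_Icc]
      omega
    · intro a _ b _ h
      simpa using h
    · intro b hb
      rw [Finset.mem_Icc] at hb
      exact ⟨(b - 1).toNat, by rw [Finset.mem_range]; omega, by push_cast; omega⟩
    · intro m _
      rfl
  have hg0 : g 0 ≤ G := by simpa using hG 0 (Nat.zero_le _)
  have hg00 := hg 0
  have e0 : |α⁻¹ * g 0| ≤ α⁻¹ * G := by
    rw [abs_of_nonneg (by positivity)]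
    gcongr
  rw [hfib]
  rw [hzero] at hcard
  set P := ∑ m ∈ Finset.range (M + 1), g m * sawtooth (m * -α⁻¹ + (β * α⁻¹ - α⁻¹))
  set Q := ∑ m ∈ Finset.range (M + 1), g m * sawtooth (m * -α⁻¹ + β * α⁻¹)
  set R := ∑ m ∈ Finset.range (M + 1), g m * r m
  set D := ∑ m ∈ Finset.range (M + 1), g m * c m
  set Z := ∑ m ∈ Finset.Icc (1 : ℤ) M, g m
  have e1 : R - α⁻¹ * Z = (R - D) + α⁻¹ * g 0 + P - Q := by rw [hcard]; ring
  rw [e1]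
  refine (abs_sub _ _).trans ?_
  have e2 := (abs_add_le (R - D + α⁻¹ * g 0) P)
  have e3 := (abs_add_le (R - D) (α⁻¹ * g 0))
  linarith

/-! ### The von Mangoldt function along Beatty sequences -/

theorem intVonMangoldt_nonneg (k : ℤ) : 0 ≤ intVonMangoldt k :=
  ArithmeticFunction.vonMangoldt_nonneg

theorem intVonMangoldt_of_neg {q a : ℕ} (haq : a < q) {m : ℤ} (hm : m < 0) :
    intVonMangoldt (q * m + a) = 0 := by
  have : (q : ℤ) * m + a ≤ 0 := by
    have : (q : ℤ) * m ≤ q * (-1) := by gcongr; omega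
    omega
  rw [intVonMangoldt, Int.toNat_of_nonpos this, ArithmeticFunction.map_zero]

theorem intVonMangoldt_natCast (q m a : ℕ) :
    intVonMangoldt ((q : ℤ) * m + a) = ArithmeticFunction.vonMangoldt (q * m + a) := by
  rw [intVonMangoldt]
  congr 1

/-- The comparison in terms of a parameter `W`, a small power of `N`: with `Y = W ^ 4`, `W ^ 2`
Fourier coefficients and the smoothing length `1 / W`, the saving is a factor `W`. -/
theorem exists_abs_sum_beatty_vonMangoldt_le {α c η : ℝ} {r : ℕ} (hα : 0 < α) (hc : 0 < c)
    (hc1 : c ≤ 1) (hη : 0 < η)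
    (h : ∀ n : ℕ, 0 < n → c ≤ (n : ℝ) ^ r * distNearestInt (n * -α⁻¹)) (β : ℝ) :
    ∃ C : ℝ, 0 < C ∧ ∀ N M a q W : ℕ, ⌊α * N + β⌋ = M → a < q → q ≤ W → W ≤ N →
      (W ^ 4) ^ (4 * (4 * r ^ 2 + 9 * r + 5)) ≤ M →
      |(∑ n ∈ Finset.Icc 1 N, intVonMangoldt ((q : ℤ) * ⌊α * (n : ℝ) + β⌋ + (a : ℤ))) -
          α⁻¹ * ∑ m ∈ Finset.Icc (1 : ℤ) M, intVonMangoldt ((q : ℤ) * m + (a : ℤ))|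
        ≤ C * ((N : ℝ) ^ 2) ^ η * N / W := by
  obtain ⟨C₀, hC₀, hS⟩ := exists_norm_sum_progression_le hc hc1 hη h
  set D : ℝ := α + |β| + 1 with hD
  have hD0 : 0 < D := by positivity
  set c₁ : ℝ := 1 + 1 / η with hc₁
  have hc₁0 : 0 < c₁ := by positivity
  set E : ℝ := (α⁻¹ + 1) * (|α + β| + 2) + α⁻¹ with hE
  have hE0 : 0 < E := by positivity
  refine ⟨(2 * (D * (2 * c₁ + C₀)) + E * c₁) * D ^ η, by positivity,
    fun N M a q W hM haq hqW hWN hWM => ?_⟩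
  have hW : 0 < W := by omega
  have hN : 0 < N := by omega
  have hW1 : (1 : ℝ) ≤ W := by exact_mod_cast hW
  have hW0 : (0 : ℝ) < W := by linarith
  have hN1 : (1 : ℝ) ≤ N := by exact_mod_cast hN
  have hWN' : (W : ℝ) ≤ N := by exact_mod_cast hWN
  set X : ℕ := q * M + a with hX
  have hMX : M ≤ X := by nlinarith
  have hX0 : 0 < X := lt_of_lt_of_le (by positivity) (hWM.trans hMX)
  have hX1 : (1 : ℝ) ≤ X := by exact_mod_cast hX0
  have hMN : (M : ℝ) + 1 ≤ D * N := by
    have h1 : (M : ℝ) ≤ α * N + β := by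
      have := Int.floor_le (α * N + β)
      rw [hM] at this
      exact_mod_cast this
    have h2 := le_abs_self β
    have h3 : |β| ≤ |β| * N := le_mul_of_one_le_right (abs_nonneg _) hN1
    rw [hD]
    nlinarith
  have hXN : (X : ℝ) ≤ W * (D * N) := by
    have h1 : X ≤ W * (M + 1) := by
      calc X ≤ q * M + q := by omega
        _ = q * (M + 1) := by ring
        _ ≤ W * (M + 1) := Nat.mul_le_mul_right _ hqW
    calc (X : ℝ) ≤ ((W * (M + 1) : ℕ) : ℝ) := by exact_mod_cast h1
      _ = W * ((M : ℝ) + 1) := by push_cast; ring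
      _ ≤ W * (D * N) := by gcongr
  set P : ℝ := (X : ℝ) ^ η with hP
  have hP0 : 0 < P := by positivity
  have hPN : P ≤ D ^ η * ((N : ℝ) ^ 2) ^ η := by
    rw [hP, ← Real.mul_rpow hD0.le (by positivity)]
    refine Real.rpow_le_rpow (by positivity) (hXN.trans ?_) hη.le
    nlinarith
  set f : ℕ → ℝ := fun m => ArithmeticFunction.vonMangoldt (q * m + a) with hf
  have hf0 : ∀ m, 0 ≤ f m := fun m => ArithmeticFunction.vonMangoldt_nonneg
  have hfG : ∀ m ≤ M, f m ≤ c₁ * P := by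
    intro m hm
    have h1 : q * m + a ≤ X := by rw [hX]; gcongr
    have h2 := monotone_log_natCast h1
    have h3 := log_le_rpow_of_one_le hη hX1
    have h4 : f m ≤ Real.log ((q * m + a : ℕ) : ℝ) := ArithmeticFunction.vonMangoldt_le_log
    simp only at h2
    linarith
  set F := ∑ m ∈ Finset.range (M + 1), f m with hF
  have hFle : F ≤ D * N * (c₁ * P) := by
    refine (Finset.sum_le_card_nsmul _ _ (c₁ * P) fun m hm =>
      hfG m (Nat.le_of_lt_succ (Finset.mem_range.1 hm))).trans ?_
    rw [nsmul_eq_mul, Finset.card_range]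
    push_cast
    gcongr
  have hF0 : 0 ≤ F := Finset.sum_nonneg fun m _ => hf0 m
  have hW4 : (W ^ 4) ^ 2 = W ^ 8 := by ring
  have hSk : ∀ k : ℕ, 0 < k → k ≤ W ^ 2 →
      ‖∑ m ∈ Finset.range (M + 1), (f m : ℂ) * unitExp (m * (k * -α⁻¹))‖
        ≤ C₀ * P * (D * N) / W ^ 3 := by
    intro k hk hkW
    have h1 := hS q a k M (W ^ 4) haq
      (by rw [hW4]; exact hqW.trans (Nat.le_self_pow (by norm_num) W)) hk
      (by rw [hW4]; exact hkW.trans (Nat.pow_le_pow_right hW (by norm_num)))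
      (hWM.trans hMX)
    refine h1.trans ?_
    calc C₀ * (X : ℝ) ^ η * X / (W ^ 4 : ℕ) ≤ C₀ * P * (W * (D * N)) / (W ^ 4 : ℕ) := by gcongr
      _ = C₀ * P * (D * N) / W ^ 3 := by push_cast; field_simp
  have hsaw : ∀ δ : ℝ, |∑ m ∈ Finset.range (M + 1), f m * sawtooth (m * -α⁻¹ + δ)|
      ≤ D * (2 * c₁ + C₀) * (P * (N / W)) := by
    intro δ
    refine (abs_sum_mul_sawtooth_le hf0 _ (K := W ^ 2) (Δ := 1 / W) (by positivity)
      (by positivity) (by rw [div_le_one hW0]; exact hW1) hSk δ).trans ?_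
    have h1 : 1 / (W : ℝ) * F + (C₀ * P * (D * N) / W ^ 3 + F / (W ^ 2 : ℕ)) / (1 / W)
        = 2 * (F / W) + C₀ * P * (D * N) / W / W := by
      push_cast
      field_simp
      ring
    have h2 : C₀ * P * (D * N) / W / W ≤ C₀ * P * (D * N) / W :=
      div_le_self (by positivity) hW1
    have h3 : F / W ≤ D * N * (c₁ * P) / W := by gcongr
    calc _ ≤ 2 * (D * N * (c₁ * P) / W) + C₀ * P * (D * N) / W := by rw [h1]; linarith
      _ = _ := by ring
  have main := abs_sum_beatty_sub_le (β := β) hα (g := fun m => intVonMangoldt ((q : ℤ) * m + a))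
    (G := c₁ * P) hM (fun m => intVonMangoldt_nonneg _) (fun m hm => intVonMangoldt_of_neg haq hm)
    (fun m hm => by rw [intVonMangoldt_natCast]; exact hfG m hm)
  simp only [intVonMangoldt_natCast] at main
  refine main.trans ?_
  have hNW : 1 ≤ (N : ℝ) / W := by rw [le_div_iff₀ hW0]; linarith
  have h1 := hsaw (β * α⁻¹ - α⁻¹)
  have h2 := hsaw (β * α⁻¹)
  have h3 : E * (c₁ * P) ≤ E * c₁ * (P * (N / W)) := by
    have : P ≤ P * (N / W) := le_mul_of_one_le_right hP0.le hNW
    have h4 := mul_le_mul_of_nonneg_left this (by positivity : 0 ≤ E * c₁)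
    linarith
  calc _ ≤ D * (2 * c₁ + C₀) * (P * (N / W)) + D * (2 * c₁ + C₀) * (P * (N / W))
          + E * c₁ * (P * (N / W)) := add_le_add (add_le_add h1 h2) h3
    _ = (2 * (D * (2 * c₁ + C₀)) + E * c₁) * (P * (N / W)) := by ring
    _ ≤ (2 * (D * (2 * c₁ + C₀)) + E * c₁) * (D ^ η * ((N : ℝ) ^ 2) ^ η * (N / W)) := by gcongr
    _ = _ := by ring

/-- For large `N` some power of `⌊N ^ σ⌋` is still smaller than `⌊α N + β⌋`. -/
theorem exists_floor_rpow_pow_le {α : ℝ} (hα : 0 < α) (β : ℝ) {t : ℕ} (ht : 0 < t) :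
    ∃ N₀ : ℕ, ∀ N : ℕ, N₀ ≤ N →
      ((⌊(N : ℝ) ^ (1 / (2 * t : ℝ))⌋₊ ^ t : ℕ) : ℤ) ≤ ⌊α * N + β⌋ := by
  refine ⟨⌈((|β| + 1) / α) ^ 2⌉₊ + 1, fun N hN => ?_⟩
  have h1 : ((|β| + 1) / α) ^ 2 ≤ N :=
    (Nat.le_ceil _).trans (by exact_mod_cast (Nat.le_succ _).trans hN)
  have hN1 : (1 : ℝ) ≤ N := by exact_mod_cast (by omega : 1 ≤ N)
  have h2 : (|β| + 1) / α ≤ Real.sqrt N := Real.le_sqrt_of_sq_le h1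
  have h3 : 1 ≤ Real.sqrt N := Real.one_le_sqrt.2 hN1
  have h4 : Real.sqrt N * Real.sqrt N = N := Real.mul_self_sqrt (by linarith)
  rw [div_le_iff₀ hα] at h2
  have h5 : Real.sqrt N ≤ α * N + β := by
    have := neg_abs_le β
    have := abs_nonneg β
    nlinarith
  rw [Int.le_floor]
  refine le_trans ?_ h5
  push_cast
  calc ((⌊(N : ℝ) ^ (1 / (2 * t : ℝ))⌋₊ : ℝ)) ^ t ≤ ((N : ℝ) ^ (1 / (2 * t : ℝ))) ^ t := by
        gcongr
        exact Nat.floor_le (by positivity)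
    _ = Real.sqrt N := by
        have : (t : ℝ) ≠ 0 := by exact_mod_cast ht.ne'
        rw [← Real.rpow_natCast, ← Real.rpow_mul (by linarith), Real.sqrt_eq_rpow]
        congr 1
        field_simp

theorem mainTheorem1 (α : ℝ) (hpos : 0 < α) (hirr : Irrational α) (htype : IsOfFiniteType α) :
    ∃ κ : ℝ, 0 < κ ∧ ∀ β : ℝ, ∃ C : ℝ, ∀ N a q : ℕ,
      a < q → (q : ℝ) ≤ (N : ℝ) ^ κ → Nat.Coprime a q →
        |(∑ n ∈ Finset.Icc 1 N, intVonMangoldt ((q : ℤ) * ⌊α * (n : ℝ) + β⌋ + (a : ℤ))) -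
            α⁻¹ * ∑ m ∈ Finset.Icc (1 : ℤ) ⌊α * (N : ℝ) + β⌋,
              intVonMangoldt ((q : ℤ) * m + (a : ℤ))| ≤
          C * (N : ℝ) ^ (1 - κ) := by
  obtain ⟨r, c₀, hc₀, h₀⟩ := htype.exists_le_pow_mul hirr
  obtain ⟨c, hc, hc1, hα⟩ := exists_le_pow_mul_distNearestInt_inv hpos hc₀ h₀
  have hγ : ∀ n : ℕ, 0 < n → c ≤ (n : ℝ) ^ r * distNearestInt (n * -α⁻¹) := by
    intro n hn
    rw [mul_neg, distNearestInt_neg]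
    exact hα n hn
  -- the parameter `W = ⌊N ^ σ⌋` satisfies `(W ^ 4) ^ (t / 4) = W ^ t ≤ √N`
  set t : ℕ := 4 * (4 * (4 * r ^ 2 + 9 * r + 5)) with ht
  have ht0 : 0 < t := by positivity
  have ht1 : (1 : ℝ) ≤ t := by exact_mod_cast ht0
  set σ : ℝ := 1 / (2 * t : ℝ) with hσ
  have hσ0 : 0 < σ := by positivity
  have hσ1 : σ ≤ 1 := by rw [hσ, div_le_one (by positivity)]; linarith
  refine ⟨σ / 2, by positivity, fun β => ?_⟩
  obtain ⟨C, hC, hmain⟩ :=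
    exists_abs_sum_beatty_vonMangoldt_le (η := σ / 4) hpos hc hc1 (by positivity) hγ β
  obtain ⟨N₀, hN₀⟩ := exists_floor_rpow_pow_le hpos β ht0
  set err : ℕ × ℕ × ℕ → ℝ := fun x =>
    |(∑ n ∈ Finset.Icc 1 x.1, intVonMangoldt ((x.2.2 : ℤ) * ⌊α * (n : ℝ) + β⌋ + (x.2.1 : ℤ))) -
      α⁻¹ * ∑ m ∈ Finset.Icc (1 : ℤ) ⌊α * (x.1 : ℝ) + β⌋,
        intVonMangoldt ((x.2.2 : ℤ) * m + (x.2.1 : ℤ))| with herr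
  have herr0 : ∀ x, 0 ≤ err x := fun x => abs_nonneg _
  -- only finitely many triples `(N, a, q)` have `N < N₀`
  set small := Finset.range N₀ ×ˢ Finset.range N₀ ×ˢ Finset.range N₀
  have hsmall0 : 0 ≤ ∑ x ∈ small, err x := Finset.sum_nonneg fun x _ => herr0 x
  refine ⟨2 * C + ∑ x ∈ small, err x, fun N a q haq hqN _ => ?_⟩
  have hN : 0 < N := by
    rcases Nat.eq_zero_or_pos N with rfl | h
    · rw [Nat.cast_zero, Real.zero_rpow (by positivity)] at hqN
      have : q ≤ 0 := by exact_mod_cast hqN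
      omega
    · exact h
  have hN1 : (1 : ℝ) ≤ N := by exact_mod_cast hN
  have hqN' : q ≤ N := by
    have : (N : ℝ) ^ (σ / 2) ≤ (N : ℝ) ^ (1 : ℝ) :=
      Real.rpow_le_rpow_of_exponent_le hN1 (by linarith)
    rw [Real.rpow_one] at this
    exact_mod_cast hqN.trans this
  have hpow1 : 1 ≤ (N : ℝ) ^ (1 - σ / 2) := Real.one_le_rpow hN1 (by linarith)
  change err (N, a, q) ≤ _
  rcases lt_or_ge N N₀ with hlt | hge
  · have hmem : (N, a, q) ∈ small := by
      simp only [small, Finset.mem_product, Finset.mem_range]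
      omega
    have h1 := Finset.single_le_sum (fun x _ => herr0 x) hmem
    nlinarith
  · set W := ⌊(N : ℝ) ^ σ⌋₊ with hW
    have hNσ : 1 ≤ (N : ℝ) ^ σ := Real.one_le_rpow hN1 hσ0.le
    have hqW : q ≤ W := Nat.le_floor (hqN.trans
      (Real.rpow_le_rpow_of_exponent_le hN1 (by linarith)))
    have hWN : W ≤ N := by
      have h1 : (W : ℝ) ≤ (N : ℝ) ^ σ := Nat.floor_le (by positivity)
      have h2 : (N : ℝ) ^ σ ≤ (N : ℝ) ^ (1 : ℝ) := Real.rpow_le_rpow_of_exponent_le hN1 hσ1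
      rw [Real.rpow_one] at h2
      exact_mod_cast h1.trans h2
    have hW0 : (0 : ℝ) < W := by exact_mod_cast (by omega : 0 < W)
    have hW2 : (N : ℝ) ^ σ ≤ 2 * W := by
      have h1 := Nat.lt_floor_add_one ((N : ℝ) ^ σ)
      have h2 : (1 : ℝ) ≤ W := by exact_mod_cast (by omega : 1 ≤ W)
      linarith
    have hle : ((W ^ t : ℕ) : ℤ) ≤ ⌊α * N + β⌋ := hN₀ N hge
    obtain ⟨M, hM⟩ := Int.eq_ofNat_of_zero_le (le_trans (by positivity) hle)
    have hWM : (W ^ 4) ^ (4 * (4 * r ^ 2 + 9 * r + 5)) ≤ M := by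
      rw [← pow_mul, ← ht]
      rw [hM] at hle
      exact_mod_cast hle
    have h1 := hmain N M a q W hM haq hqW hWN hWM
    have h2 : err (N, a, q) ≤ C * ((N : ℝ) ^ 2) ^ (σ / 4) * N / W := by
      simp only [herr]
      rw [hM]
      exact h1
    have h3 : C * ((N : ℝ) ^ 2) ^ (σ / 4) * N / W ≤ 2 * C * (N : ℝ) ^ (1 - σ / 2) := by
      rw [div_le_iff₀ hW0]
      have h4 : ((N : ℝ) ^ 2) ^ (σ / 4) * N = (N : ℝ) ^ (1 - σ / 2) * (N : ℝ) ^ σ := by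
        have hN0 : (0 : ℝ) < N := by linarith
        rw [← Real.rpow_natCast, ← Real.rpow_mul hN0.le, ← Real.rpow_add hN0]
        nth_rewrite 2 [← Real.rpow_one (N : ℝ)]
        rw [← Real.rpow_add hN0]
        congr 1
        push_cast
        ring
      calc C * ((N : ℝ) ^ 2) ^ (σ / 4) * N = C * ((N : ℝ) ^ (1 - σ / 2) * (N : ℝ) ^ σ) := by
            rw [mul_assoc, h4]
        _ ≤ C * ((N : ℝ) ^ (1 - σ / 2) * (2 * W)) := by gcongr
        _ = _ := by ring
    have h5 : 0 ≤ (∑ x ∈ small, err x) * (N : ℝ) ^ (1 - σ / 2) := by positivity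
    linarith
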